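/- **Conventions.** Write $\zeta_n = e^{2\pi i/n}$. A *cyclotomic integer* is an algebraic integer $\alpha\in\mathbb{C}$ lying in some $\mathbb{Q}(\zeta_n)$. The *house* $\overline{|\alpha|}$ of an algebraic integer $\alpha$ is the maximum of $|\beta|$ over the conjugates $\beta$ of $\alpha$ in $\mathbb{C}$. Algebraic integers $\alpha,\beta$ are *equivalent* if $\beta$ equals a root of unity times a conjugate of $\alpha$. A cyclotomic integer $\alpha$ is *covered* if it satisfies one of the following. 1. $\alpha$ is a sum of at most two roots of unity. 2. $\alpha$ is equivalent to $1+\zeta-\zeta^{-1}$ for some root of unity $\zeta$. 3. $\alpha$ is equivalent to $(\zeta_5+\zeta_5^4)+(\zeta_5^2+\zeta_5^3)\zeta$ for some root of unity $\zeta$. 4. $\alpha$ is equivalent to one of the following 33 numbers, where in each item $\zeta=\zeta_n$ for the given $n$: - $n=11$: $1+\zeta+\zeta^2+\zeta^4-\zeta^5+\zeta^7$, $\ 1+\zeta+\zeta^2+\zeta^5$, $\ 1+\zeta+\zeta^2+\zeta^4+\zeta^7$; - $n=19$: $1+\zeta+\zeta^4+\zeta^7+\zeta^8+\zeta^9+\zeta^{10}+\zeta^{12}+\zeta^{14}$;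 - $n=20$: $1+\zeta+\zeta^3-\zeta^4$; - $n=24$: $1+\zeta+\zeta^5-\zeta^6$, $\ 1+\zeta+\zeta^7$; - $n=31$: $1+\zeta+\zeta^3+\zeta^8+\zeta^{12}+\zeta^{18}$; - $n=51$: $1+\zeta^3-\zeta^{10}+\zeta^{15}+\zeta^{21}+\zeta^{24}+\zeta^{30}+\zeta^{33}+\zeta^{39}$; - $n=84$: $1-\zeta^4-\zeta^{13}-\zeta^{16}+\zeta^{19}+\zeta^{21}+\zeta^{22}+\zeta^{31}$; - $n=91$: $1+\zeta^7+\zeta^{14}-\zeta^{17}+\zeta^{21}+\zeta^{42}-\zeta^{69}+\zeta^{70}-\zeta^{82}$; - $n=33$: $1+\zeta^6-\zeta^8+\zeta^{21}$, $\ 1+\zeta^6-\zeta^7-\zeta^{10}$; - $n=28$: $1+\zeta-\zeta^3-\zeta^{11}$, $\ 1+\zeta-\zeta^3+\zeta^4$; - $n=21$: $1-\zeta-\zeta^5+\zeta^{18}$, $\ 1-\zeta+\zeta^6+\zeta^{18}$, $\ 1-\zeta-\zeta^4+\zeta^{12}$, $\ 1-\zeta-\zeta^{13}$; - $n=60$: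 $1-\zeta^3-\zeta^6-\zeta^8$, $\ 1-\zeta^3-\zeta^5-\zeta^8$; - $n=35$: $1-\zeta^6+\zeta^7+\zeta^{10}+\zeta^{15}+\zeta^{17}+\zeta^{22}$, $\ 1-\zeta+\zeta^7-\zeta^{11}-\zeta^{16}$; - $n=40$: $1-\zeta^3+\zeta^7+\zeta^{10}$; - $n=13$: $1+\zeta+\zeta^4$, $\ 1+\zeta+\zeta^3+\zeta^9$; - $n=39$: $1-\zeta^2-\zeta^5-\zeta^8-\zeta^{11}-\zeta^{20}-\zeta^{32}$; - $n=55$: $1-\zeta-\zeta^{16}+\zeta^{22}-\zeta^{26}-\zeta^{31}-\zeta^{36}$; - $n=7$: $1+\zeta+\zeta^3$, $\ (1+\zeta+\zeta^3)^2$, $\ (1+i)(1+\zeta+\zeta^3)$; - and $(1+i)(1-\zeta_{15}+\zeta_{15}^{12})$, $\ (1+\zeta_7+\zeta_7^3)(1-\zeta_{15}+\zeta_{15}^{12})$. **Lemma.** Let $(\ell,c,p_0)\in\{(2,4,11),(5,5,7)\}$, and let $p\ge p_0$ be a prime such that $\frac{p-1}{2}$ is also prime. (This forces $p\equiv 3 \pmod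 4$.) Let $N$ be a positive integer coprime to $\ell p$ such that for every prime $q$ dividing $N$, the order of $\ell$ in $(\mathbb{Z}/q\mathbb{Z})^\times$ is not divisible by $\frac{p-1}{2}$. (For a given $q$ this is automatic if $\frac{p-1}{2}$ does not divide $q-1$.) Then every algebraic integer $\alpha\in\mathbb{Q}(\zeta_{pN})$ with $\overline{|\alpha|}^{\,2}=c$ is either covered or equivalent to an element of $\mathbb{Q}(\zeta_N)$. -/

import Mathlib

namespace CyclotomicCastle

/-- The root of unity `ζ_N = e^{2πi/N}` in `ℂ`. -/
noncomputable def zeta (N : ℕ) : ℂ := Complex.exp (2 * Real.pi * Complex.I / N)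

/-- The cyclotomic field `ℚ(ζ_N)`, as a subfield of `ℂ`. -/
noncomputable def cycloField (N : ℕ) : IntermediateField ℚ ℂ :=
  IntermediateField.adjoin ℚ {zeta N}

/-- `z` is a root of unity (of some positive order). -/
def IsRootOfOne (z : ℂ) : Prop := ∃ n : ℕ, 0 < n ∧ z ^ n = 1

/-- The house of an algebraic number `α`: the largest absolute value of a conjugate of `α` in `ℂ`
(the conjugates being the complex numbers with the same minimal polynomial over `ℚ`). -/
noncomputable def house (α : ℂ) : ℝ := sSup {r : ℝ | ∃ β : ℂ, IsConjRoot ℚ α β ∧ r = ‖β‖}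

/-- For an algebraic number the supremum in the definition of the house is a maximum. -/
theorem isGreatest_house {α : ℂ} (h : IsIntegral ℚ α) :
    IsGreatest {r : ℝ | ∃ β : ℂ, IsConjRoot ℚ α β ∧ r = ‖β‖} (house α) := by
  have hfin : {r : ℝ | ∃ β : ℂ, IsConjRoot ℚ α β ∧ r = ‖β‖}.Finite := by
    refine (((minpoly ℚ α).rootSet_finite ℂ).image (fun β : ℂ => ‖β‖)).subset ?_
    rintro r ⟨β, hβ, rfl⟩
    refine ⟨β, ?_, rfl⟩
    rw [Polynomial.mem_rootSet]
    refine ⟨minpoly.ne_zero h, ?_⟩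
    rw [show minpoly ℚ α = minpoly ℚ β from hβ]
    exact minpoly.aeval ℚ β
  have hne : {r : ℝ | ∃ β : ℂ, IsConjRoot ℚ α β ∧ r = ‖β‖}.Nonempty := ⟨‖α‖, α, rfl, rfl⟩
  exact ⟨hne.csSup_mem hfin, fun r hr => le_csSup hfin.bddAbove hr⟩

/-- Equivalence of algebraic integers: `β` is a root of unity times a conjugate of `α`. -/
def Equivalent (α β : ℂ) : Prop :=
  ∃ ω α' : ℂ, IsRootOfOne ω ∧ IsConjRoot ℚ α α' ∧ β = ω * α'

/-- First form: a sum of at most two roots of unity. -/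
def IsSumOfAtMostTwo (α : ℂ) : Prop :=
  ∃ s : Multiset ℂ, Multiset.card s ≤ 2 ∧ (∀ z ∈ s, IsRootOfOne z) ∧ α = s.sum

/-- Second form: equivalent to `1 + ω - ω⁻¹` for some root of unity `ω`. -/
def IsSecondForm (α : ℂ) : Prop :=
  ∃ ω : ℂ, IsRootOfOne ω ∧ Equivalent α (1 + ω - ω⁻¹)

/-- Third form: equivalent to `(ζ₅ + ζ₅⁴) + (ζ₅² + ζ₅³) ω` for some root of unity `ω`. -/
def IsThirdForm (α : ℂ) : Prop :=
  ∃ ω : ℂ, IsRootOfOne ω ∧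
    Equivalent α ((zeta 5 + zeta 5 ^ 4) + (zeta 5 ^ 2 + zeta 5 ^ 3) * ω)

/-- The table of exceptional cyclotomic integers (the numbers in the comments are the squares of
the houses). -/
def exceptional : Set ℂ :=
  { -- 5
    1 + zeta 11 + zeta 11 ^ 2 + zeta 11 ^ 4 - zeta 11 ^ 5 + zeta 11 ^ 7,
    1 + zeta 19 + zeta 19 ^ 4 + zeta 19 ^ 7 + zeta 19 ^ 8 + zeta 19 ^ 9 + zeta 19 ^ 10
      + zeta 19 ^ 12 + zeta 19 ^ 14,
    1 + zeta 20 + zeta 20 ^ 3 - zeta 20 ^ 4,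
    1 + zeta 24 + zeta 24 ^ 5 - zeta 24 ^ 6,
    1 + zeta 31 + zeta 31 ^ 3 + zeta 31 ^ 8 + zeta 31 ^ 12 + zeta 31 ^ 18,
    1 + zeta 51 ^ 3 - zeta 51 ^ 10 + zeta 51 ^ 15 + zeta 51 ^ 21 + zeta 51 ^ 24 + zeta 51 ^ 30
      + zeta 51 ^ 33 + zeta 51 ^ 39,
    1 - zeta 84 ^ 4 - zeta 84 ^ 13 - zeta 84 ^ 16 + zeta 84 ^ 19 + zeta 84 ^ 21 + zeta 84 ^ 22
      + zeta 84 ^ 31,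
    1 + zeta 91 ^ 7 + zeta 91 ^ 14 - zeta 91 ^ 17 + zeta 91 ^ 21 + zeta 91 ^ 42 - zeta 91 ^ 69
      + zeta 91 ^ 70 - zeta 91 ^ 82,
    -- strictly between 4 and 5
    1 + zeta 33 ^ 6 - zeta 33 ^ 8 + zeta 33 ^ 21,
    1 + zeta 28 - zeta 28 ^ 3 - zeta 28 ^ 11,
    1 + zeta 33 ^ 6 - zeta 33 ^ 7 - zeta 33 ^ 10,
    1 - zeta 21 - zeta 21 ^ 5 + zeta 21 ^ 18,
    1 + zeta 28 - zeta 28 ^ 3 + zeta 28 ^ 4,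
    1 - zeta 21 + zeta 21 ^ 6 + zeta 21 ^ 18,
    1 - zeta 60 ^ 3 - zeta 60 ^ 6 - zeta 60 ^ 8,
    1 + zeta 11 + zeta 11 ^ 2 + zeta 11 ^ 5,
    1 - zeta 35 ^ 6 + zeta 35 ^ 7 + zeta 35 ^ 10 + zeta 35 ^ 15 + zeta 35 ^ 17 + zeta 35 ^ 22,
    1 - zeta 40 ^ 3 + zeta 40 ^ 7 + zeta 40 ^ 10,
    1 - zeta 60 ^ 3 - zeta 60 ^ 5 - zeta 60 ^ 8,
    1 + zeta 24 + zeta 24 ^ 7,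
    1 + zeta 13 + zeta 13 ^ 4,
    1 - zeta 21 - zeta 21 ^ 4 + zeta 21 ^ 12,
    -- 4
    (1 + zeta 7 + zeta 7 ^ 3) ^ 2,
    (1 + Complex.I) * (1 + zeta 7 + zeta 7 ^ 3),
    1 - zeta 39 ^ 2 - zeta 39 ^ 5 - zeta 39 ^ 8 - zeta 39 ^ 11 - zeta 39 ^ 20 - zeta 39 ^ 32,
    1 - zeta 55 - zeta 55 ^ 16 + zeta 55 ^ 22 - zeta 55 ^ 26 - zeta 55 ^ 31 - zeta 55 ^ 36,
    (1 + Complex.I) * (1 - zeta 15 + zeta 15 ^ 12),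
    (1 + zeta 7 + zeta 7 ^ 3) * (1 - zeta 15 + zeta 15 ^ 12),
    -- less than 4
    1 - zeta 21 - zeta 21 ^ 13,
    1 + zeta 11 + zeta 11 ^ 2 + zeta 11 ^ 4 + zeta 11 ^ 7,
    1 + zeta 13 + zeta 13 ^ 3 + zeta 13 ^ 9,
    1 - zeta 35 + zeta 35 ^ 7 - zeta 35 ^ 11 - zeta 35 ^ 16,
    1 + zeta 7 + zeta 7 ^ 3 }

/-- `α` is covered by the classification: it has one of the three forms, or it is equivalent to an
entry of the table. -/
def Covered (α : ℂ) : Prop :=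
  IsSumOfAtMostTwo α ∨ IsSecondForm α ∨ IsThirdForm α ∨ ∃ β ∈ exceptional, Equivalent α β

end CyclotomicCastle

namespace CyclotomicCastle

/-! Write `C` for the rational integer called c in the statement, `c` for complex conjugation on `K
= ℚ(ζ_{pN})`, `M = pN` and `r = (p - 1) / 2`. Since the square of the house is rational and `c`
commutes with all embeddings, `α * c α = C`; every conjugate of `α` has absolute value `√C`.

Frobenius. Let `σ : ζ ↦ ζ ^ ℓ`. Then `α` divides `σ α`: for `C = ℓ = 5` because `σ α ≡ α ^ 5` modulo
5, for `C = 4`, `ℓ = 2` by a finer computation (`intDvd_aut_of_mul_conj_eq_four`). The quotient has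
absolute value 1 everywhere, so by Kronecker `σ α = u * α` with `u` a root of unity, and a twist of
`α` by a `p`-th root of unity removes the `p`-part of `u`. The hypothesis on the primes `q ∣ N`
yields a power `x = ℓ ^ k` of order `r` modulo `p`, congruent to 1 modulo every `q ∣ N` and of
`r`-power order modulo `N` (`exists_pow_order`).

Case `x ≡ 1` modulo `N`. Then `s = σ ^ k` is an inertia element at `p`, and ramification forces `s α
= α`. Let `κ` be the inertia involution. The difference `α - κ α` is fixed by `s` and divisible by
`1 - ζ_p`, hence by `(1 - ζ_p) ^ r`, so `|α - κ α| ^ 2 = p * β` with `β` an algebraic integer whose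
conjugates lie in `[0, 4C/p]`. If `β = 0`, then `α ∈ ℚ(ζ_N)`. Otherwise `p ≤ 4C` leaves `p = 7, 11`,
and `β ∈ {1, 2}`. Writing `2α = B(A + √-p)` with `|B| ^ 2 = β` and `β(A ^ 2 + p) = 4C` gives four
explicit numbers, all in the table.

Case `x ≢ 1` modulo `N`. Some `x ^ (r ^ j)` has order exactly `r` modulo `N`, which forces `r ^ 2 ∣
N`. If `j > 0`, this power is 1 modulo `p`, and the corresponding power of `σ` generates the Galois
group over `ℚ(ζ_{M/r})`; a twist makes `α` fixed. If `j = 0`, the automorphism is a product `s * τ`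
of a part at `p` and a part at `r`. The `τ`-eigencomponents of `α` are integral, and those with
nontrivial eigenvalue are highly divisible at `p`; size considerations leave a single component
(`exists_eigenvalue_of_fixed`), so `α` is a `τ`-eigenvector and descends as before. Induction on `N`
finishes the proof. -/

/-! ### Divisibility among algebraic integers, inside the field -/

/-- `d` divides `x` in the ring of algebraic integers of the field `K`. -/
def IntDvd {K : Type*} [Field K] (d x : K) : Prop := ∃ y : K, IsIntegral ℤ y ∧ x = d * y

namespace IntDvd

variable {K : Type*} [Field K] {d e x y : K}

theorem zero (d : K) : IntDvd d 0 := ⟨0, isIntegral_zero, by simp⟩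

theorem mul_self_right (d : K) (hy : IsIntegral ℤ y) : IntDvd d (d * y) := ⟨y, hy, rfl⟩

theorem add (hx : IntDvd d x) (hy : IntDvd d y) : IntDvd d (x + y) := by
  obtain ⟨a, ha, rfl⟩ := hx
  obtain ⟨b, hb, rfl⟩ := hy
  exact ⟨a + b, ha.add hb, by ring⟩

theorem neg (hx : IntDvd d x) : IntDvd d (-x) := by
  obtain ⟨a, ha, rfl⟩ := hx
  exact ⟨-a, ha.neg, by ring⟩

theorem sub (hx : IntDvd d x) (hy : IntDvd d y) : IntDvd d (x - y) := by
  rw [sub_eq_add_neg]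
  exact hx.add hy.neg

theorem mul_left (hx : IntDvd d x) (hy : IsIntegral ℤ y) : IntDvd d (y * x) := by
  obtain ⟨a, ha, rfl⟩ := hx
  exact ⟨y * a, hy.mul ha, by ring⟩

theorem mul_right (hx : IntDvd d x) (hy : IsIntegral ℤ y) : IntDvd d (x * y) := by
  rw [mul_comm]
  exact hx.mul_left hy

theorem mul (hx : IntDvd d x) (hy : IntDvd e y) : IntDvd (d * e) (x * y) := by
  obtain ⟨a, ha, rfl⟩ := hx
  obtain ⟨b, hb, rfl⟩ := hy
  exact ⟨a * b, ha.mul hb, by ring⟩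

theorem pow (hx : IntDvd d x) (n : ℕ) : IntDvd (d ^ n) (x ^ n) := by
  obtain ⟨a, ha, rfl⟩ := hx
  exact ⟨a ^ n, ha.pow n, by ring⟩

theorem trans (hx : IntDvd d e) (hy : IntDvd e x) : IntDvd d x := by
  obtain ⟨a, ha, rfl⟩ := hx
  obtain ⟨b, hb, rfl⟩ := hy
  exact ⟨a * b, ha.mul hb, by ring⟩

theorem sum {ι : Type*} {s : Finset ι} {f : ι → K} (h : ∀ i ∈ s, IntDvd d (f i)) :
    IntDvd d (∑ i ∈ s, f i) := by
  classical
  induction s using Finset.induction_on with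
  | empty => simpa using zero d
  | insert a s ha ih =>
    rw [Finset.sum_insert ha]
    exact (h a (Finset.mem_insert_self a s)).add
      (ih fun i hi => h i (Finset.mem_insert_of_mem hi))

theorem map [CharZero K] (hx : IntDvd d x) (σ : K ≃ₐ[ℚ] K) : IntDvd (σ d) (σ x) := by
  obtain ⟨a, ha, rfl⟩ := hx
  exact ⟨σ a, ha.map (σ : K →+* K).toIntAlgHom, by simp⟩

end IntDvd

theorem isIntegral_natCast' {K : Type*} [Field K] (n : ℕ) : IsIntegral ℤ (n : K) := by
  simpa using isIntegral_algebraMap (R := ℤ) (A := K) (x := (n : ℤ))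

theorem isIntegral_intCast' {K : Type*} [Field K] (n : ℤ) : IsIntegral ℤ (n : K) := by
  simpa using isIntegral_algebraMap (R := ℤ) (A := K) (x := n)

theorem isIntegral_of_pow_eq_one {K : Type*} [Field K] {u : K} {n : ℕ} (hn : 0 < n)
    (h : u ^ n = 1) : IsIntegral ℤ u :=
  IsIntegral.of_pow hn (h ▸ isIntegral_one)

theorem isIntegral_apply {K : Type*} [Field K] [CharZero K] {x : K} (hx : IsIntegral ℤ x)
    (σ : K ≃ₐ[ℚ] K) : IsIntegral ℤ (σ x) := hx.map (σ : K →+* K).toIntAlgHom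

theorem IntDvd.dvd_of_natCast {K : Type*} [Field K] [CharZero K] {p k : ℕ} (hp : p ≠ 0)
    (h : IntDvd (p : K) (k : K)) : p ∣ k := by
  obtain ⟨y, hy, hxy⟩ := h
  have hpK : (p : K) ≠ 0 := by exact_mod_cast hp
  have hy' : y = algebraMap ℚ K ((k : ℚ) / p) := by
    rw [map_div₀, map_natCast, map_natCast, eq_div_iff hpK, hxy, mul_comm]
  rw [hy', isIntegral_algebraMap_iff (algebraMap ℚ K).injective] at hy
  obtain ⟨z, hz⟩ := IsIntegrallyClosed.isIntegral_iff.1 hy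
  have hpQ : (p : ℚ) ≠ 0 := by exact_mod_cast hp
  rw [eq_div_iff hpQ] at hz
  have : (k : ℤ) = p * z := by
    have : ((k : ℤ) : ℚ) = ((p * z : ℤ) : ℚ) := by
      push_cast
      rw [← hz, mul_comm]
      simp
    exact_mod_cast this
  exact Int.natCast_dvd_natCast.1 ⟨z, this⟩

/-! ### Divisibility by `1 - u` for a root of unity `u` -/

section RootsOfUnity

variable {K : Type*} [Field K] {u : K} {n : ℕ}

theorem IntDvd.one_sub_pow (hu : IsIntegral ℤ u) (k : ℕ) : IntDvd (1 - u) (1 - u ^ k) := by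
  refine ⟨∑ i ∈ Finset.range k, u ^ i, IsIntegral.sum _ fun i _ => hu.pow i, ?_⟩
  rw [mul_comm, ← neg_sub u 1, mul_neg, geom_sum_mul]
  ring

theorem IntDvd.one_sub_natCast (hn : 0 < n) (hu : u ^ n = 1) (hu1 : u ≠ 1) :
    IntDvd (1 - u) (n : K) := by
  have h0 : ∑ i ∈ Finset.range n, u ^ i = 0 := by
    have := geom_sum_mul u n
    rw [hu, sub_self, mul_eq_zero] at this
    exact this.resolve_right (sub_ne_zero.2 hu1)
  have : (n : K) = ∑ i ∈ Finset.range n, (1 - u ^ i) := by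
    rw [Finset.sum_sub_distrib, h0]
    simp
  rw [this]
  exact IntDvd.sum fun i _ => IntDvd.one_sub_pow (isIntegral_of_pow_eq_one hn hu) i

/-- `p` is the product of the `1 - u ^ k` for `0 < k < p`, and `1 - u` is a multiple of each factor
because `u` is itself a power of `u ^ k`. -/
theorem IntDvd.natCast_one_sub_pow {p : ℕ} (hp : p.Prime) (hu : IsPrimitiveRoot u p) :
    IntDvd (p : K) ((1 - u) ^ (p - 1)) := by
  have hprod : ∏ k ∈ Finset.range (p - 1), (1 - u ^ (k + 1)) = (p : K) := by
    have h := IsPrimitiveRoot.prod_one_sub_pow_eq_order (n := p - 1)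
      (by rwa [Nat.sub_add_cancel hp.one_le])
    rw [h, Nat.cast_sub hp.one_le]
    simp
  have hz : ∀ k ∈ Finset.range (p - 1), ∃ z : K, IsIntegral ℤ z ∧
      1 - u = (1 - u ^ (k + 1)) * z := by
    intro k hk
    have hk' : k + 1 < p := by
      rw [Finset.mem_range] at hk
      omega
    have hcop : (k + 1).Coprime p :=
      (Nat.Coprime.symm ((Nat.Prime.coprime_iff_not_dvd hp).2
        (Nat.not_dvd_of_pos_of_lt (Nat.succ_pos k) hk')))
    have := NeZero.mk hp.ne_zero
    obtain ⟨j, hj⟩ := (hu.pow_of_coprime (k + 1) hcop).eq_pow_of_pow_eq_one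
      (ξ := u) hu.pow_eq_one |>.imp fun j h => h.2
    have := IntDvd.one_sub_pow (u := u ^ (k + 1))
      ((isIntegral_of_pow_eq_one hp.pos hu.pow_eq_one).pow _) j
    rw [hj] at this
    exact this
  choose! z hz1 hz2 using hz
  refine ⟨∏ k ∈ Finset.range (p - 1), z k, IsIntegral.prod _ hz1, ?_⟩
  rw [← hprod, ← Finset.prod_mul_distrib]
  rw [Finset.prod_congr rfl (fun k hk => (hz2 k hk).symm)]
  simp

theorem IntDvd.dvd_of_one_sub [CharZero K] {p k : ℕ} (hp : p.Prime) (hu : IsPrimitiveRoot u p)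
    (h : IntDvd (1 - u) (k : K)) : p ∣ k := by
  have := (IntDvd.natCast_one_sub_pow hp hu).trans (h.pow (p - 1))
  rw [← Nat.cast_pow] at this
  exact hp.dvd_of_dvd_pow (this.dvd_of_natCast hp.ne_zero)

end RootsOfUnity

/-! ### Kronecker's theorem -/

section Conjugates

variable {K : Type*} [Field K] [NumberField K]

theorem eq_zero_of_norm_lt_one {x : K} (hx : IsIntegral ℤ x) (h : ∀ φ : K →+* ℂ, ‖φ x‖ < 1) :
    x = 0 := by
  by_contra hx0
  obtain ⟨n, hn, hxn⟩ := NumberField.Embeddings.pow_eq_one_of_norm_le_one K ℂ hx0 hx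
    fun φ => (h φ).le
  let φ : K →+* ℂ := (IsAlgClosed.lift (R := ℚ) (S := K) (M := ℂ)).toRingHom
  have h1 : ‖φ x‖ ^ n = 1 := by rw [← norm_pow, ← map_pow, hxn, map_one, norm_one]
  exact (pow_lt_one₀ (norm_nonneg _) (h φ) hn.ne').ne h1

end Conjugates

/-! ### Galois action on cyclotomic integers -/

section Automorphisms

theorem isIntegral_of_mem_adjoin {K : Type*} [Field K] {M : ℕ} [NeZero M] {ζ : K}
    (hζ : IsPrimitiveRoot ζ M) {x : K}
    (hx : x ∈ Algebra.adjoin ℤ ({ζ} : Set K)) : IsIntegral ℤ x := by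
  have : Algebra.adjoin ℤ ({ζ} : Set K) ≤ integralClosure ℤ K :=
    Algebra.adjoin_le (Set.singleton_subset_iff.2 (hζ.isIntegral (NeZero.pos M)))
  exact this hx

theorem aut_apply_of_pow_eq_one {K : Type*} [Field K] [CharZero K] {M : ℕ} [NeZero M] {ζ : K}
    (hζ : IsPrimitiveRoot ζ M) {σ : K ≃ₐ[ℚ] K} {a : ℕ} (hσ : σ ζ = ζ ^ a)
    {u : K} (hu : u ^ M = 1) : σ u = u ^ a := by
  obtain ⟨k, -, rfl⟩ := hζ.eq_pow_of_pow_eq_one hu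
  rw [map_pow, hσ, pow_right_comm]

theorem aut_pow_apply {K : Type*} [Field K] [CharZero K] {ζ : K} {σ : K ≃ₐ[ℚ] K} {a : ℕ}
    (hσ : σ ζ = ζ ^ a) (k : ℕ) : (σ ^ k) ζ = ζ ^ (a ^ k) := by
  induction k with
  | zero => simp
  | succ k ih => rw [pow_succ, AlgEquiv.mul_apply, hσ, map_pow, ih, ← pow_mul, ← pow_succ]

variable {K : Type*} [Field K] [NumberField K] {M : ℕ} [NeZero M] [IsCyclotomicExtension {M} ℚ K]
  {ζ : K}

theorem exists_aut (hζ : IsPrimitiveRoot ζ M) {a : ℕ} (ha : a.Coprime M) :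
    ∃ σ : K ≃ₐ[ℚ] K, σ ζ = ζ ^ a := by
  refine ⟨(IsCyclotomicExtension.Rat.galEquivZMod M K).symm (ZMod.unitOfCoprime a ha), ?_⟩
  rw [IsCyclotomicExtension.Rat.galEquivZMod_apply_of_pow_eq M K _ hζ.pow_eq_one,
    MulEquiv.apply_symm_apply, ZMod.coe_unitOfCoprime, ZMod.val_natCast]
  conv_rhs => rw [← Nat.mod_add_div a M, pow_add, pow_mul, hζ.pow_eq_one, one_pow, mul_one]

theorem exists_aut_eq_pow (hζ : IsPrimitiveRoot ζ M) (σ : K ≃ₐ[ℚ] K) :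
    ∃ a : ℕ, a.Coprime M ∧ σ ζ = ζ ^ a :=
  ⟨_, ZMod.val_coe_unit_coprime _,
    IsCyclotomicExtension.Rat.galEquivZMod_apply_of_pow_eq M K σ hζ.pow_eq_one⟩

theorem mem_adjoin_of_isIntegral (hζ : IsPrimitiveRoot ζ M) {x : K} (hx : IsIntegral ℤ x) :
    x ∈ Algebra.adjoin ℤ ({ζ} : Set K) := by
  have := IsCyclotomicExtension.Rat.isIntegralClosure_adjoin_singleton (n := M) hζ
  obtain ⟨y, rfl⟩ := (IsIntegralClosure.isIntegral_iff
    (A := Algebra.adjoin ℤ ({ζ} : Set K))).1 hx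
  exact y.2

theorem adjoin_eq_top (hζ : IsPrimitiveRoot ζ M) : Algebra.adjoin ℚ ({ζ} : Set K) = ⊤ :=
  IsCyclotomicExtension.adjoin_primitive_root_eq_top (n := M) hζ

theorem ringHom_ext (hζ : IsPrimitiveRoot ζ M) {R : Type*} [Ring R] [Algebra ℚ R]
    {f g : K →+* R} (h : f ζ = g ζ) : f = g := by
  have : f.toRatAlgHom = g.toRatAlgHom :=
    AlgHom.ext_of_adjoin_eq_top (adjoin_eq_top hζ) (by simpa [Set.EqOn] using h)
  ext x
  exact DFunLike.congr_fun this x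

theorem aut_ext (hζ : IsPrimitiveRoot ζ M) {σ τ : K ≃ₐ[ℚ] K} (h : σ ζ = τ ζ) : σ = τ := by
  have : (σ : K →+* K) = (τ : K →+* K) := ringHom_ext hζ h
  ext x
  exact DFunLike.congr_fun this x

theorem aut_comm (hζ : IsPrimitiveRoot ζ M) (σ τ : K ≃ₐ[ℚ] K) (x : K) :
    σ (τ x) = τ (σ x) := by
  obtain ⟨a, -, ha⟩ := exists_aut_eq_pow hζ σ
  obtain ⟨b, -, hb⟩ := exists_aut_eq_pow hζ τ
  have : σ * τ = τ * σ := aut_ext hζ (by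
    simp only [AlgEquiv.mul_apply, ha, hb, map_pow]
    rw [pow_right_comm])
  exact DFunLike.congr_fun this x

/-- One automorphism `c` induces complex conjugation under every embedding, so an identity `α * c α
= C` controls all archimedean absolute values at once. -/
theorem embedding_conj (hζ : IsPrimitiveRoot ζ M) {c : K ≃ₐ[ℚ] K} (hc : c ζ = ζ⁻¹)
    (φ : K →+* ℂ) (x : K) : φ (c x) = (starRingEnd ℂ) (φ x) := by
  have : φ.comp (c : K →+* K) = (starRingEnd ℂ).comp φ := by
    refine ringHom_ext hζ ?_
    simp only [RingHom.comp_apply, RingHom.coe_coe, hc, map_inv₀]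
    refine (Complex.inv_eq_conj ?_)
    refine Complex.norm_eq_one_of_pow_eq_one (n := M) ?_ (NeZero.ne M)
    rw [← map_pow, hζ.pow_eq_one, map_one]
  exact DFunLike.congr_fun this x

theorem embedding_mul_conj (hζ : IsPrimitiveRoot ζ M) {c : K ≃ₐ[ℚ] K} (hc : c ζ = ζ⁻¹)
    (φ : K →+* ℂ) (x : K) : φ (x * c x) = ((‖φ x‖ ^ 2 : ℝ) : ℂ) := by
  rw [map_mul, embedding_conj hζ hc, Complex.mul_conj, Complex.normSq_eq_norm_sq]

theorem exists_conj (hζ : IsPrimitiveRoot ζ M) : ∃ c : K ≃ₐ[ℚ] K, c ζ = ζ⁻¹ := by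
  obtain ⟨c, hc⟩ := exists_aut hζ (a := M - 1) (by
    have : (M - 1).Coprime (M - 1 + 1) := by simp
    rwa [Nat.sub_add_cancel (NeZero.pos M)] at this)
  refine ⟨c, hc.trans ?_⟩
  refine eq_inv_of_mul_eq_one_left ?_
  rw [← pow_succ, Nat.sub_add_cancel (NeZero.pos M), hζ.pow_eq_one]

/-- An automorphism acts trivially modulo any `d` dividing `σ ζ - ζ`. -/
theorem intDvd_aut_sub (hζ : IsPrimitiveRoot ζ M) {d : K} (σ : K ≃ₐ[ℚ] K)
    (h : IntDvd d (σ ζ - ζ)) {x : K} (hx : IsIntegral ℤ x) : IntDvd d (σ x - x) := by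
  have hx' := mem_adjoin_of_isIntegral hζ hx
  clear hx
  induction hx' using Algebra.adjoin_induction with
  | mem x hx => simpa [Set.mem_singleton_iff.1 hx] using h
  | algebraMap r => simpa using IntDvd.zero d
  | add x y hx hy ihx ihy =>
    rw [map_add, add_sub_add_comm]
    exact ihx.add ihy
  | mul x y hx hy ihx ihy =>
    have hx' := isIntegral_of_mem_adjoin hζ hx
    have hy' := isIntegral_of_mem_adjoin hζ hy
    have : σ (x * y) - x * y = (σ x - x) * σ y + x * (σ y - y) := by
      rw [map_mul]
      ring
    rw [this]
    exact (ihx.mul_right (isIntegral_apply hy' σ)).add (ihy.mul_left hx')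

/-- The automorphism `ζ ↦ ζ ^ ℓ` is a Frobenius at `ℓ`. -/
theorem intDvd_aut_sub_pow (hζ : IsPrimitiveRoot ζ M) {ℓ : ℕ} (hℓ : ℓ.Prime) {σ : K ≃ₐ[ℚ] K}
    (hσ : σ ζ = ζ ^ ℓ) {x : K} (hx : IsIntegral ℤ x) : IntDvd (ℓ : K) (σ x - x ^ ℓ) := by
  have hx' := mem_adjoin_of_isIntegral hζ hx
  clear hx
  induction hx' using Algebra.adjoin_induction with
  | mem x hx => simpa [Set.mem_singleton_iff.1 hx, hσ] using IntDvd.zero _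
  | algebraMap r =>
    have : (ℓ : ℤ) ∣ r - r ^ ℓ := by
      have := Fact.mk hℓ
      rw [← ZMod.intCast_zmod_eq_zero_iff_dvd]
      push_cast
      rw [ZMod.pow_card, sub_self]
    obtain ⟨k, hk⟩ := this
    refine ⟨(k : K), isIntegral_intCast' k, ?_⟩
    have := congrArg (Int.cast : ℤ → K) hk
    push_cast at this
    simpa using this
  | add x y hx hy ihx ihy =>
    have hx' := isIntegral_of_mem_adjoin hζ hx
    have hy' := isIntegral_of_mem_adjoin hζ hy
    obtain ⟨r, hr⟩ := exists_add_pow_prime_eq hℓ (⟨x, hx'⟩ : integralClosure ℤ K) ⟨y, hy'⟩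
    have hr' : (x + y) ^ ℓ = x ^ ℓ + y ^ ℓ + ℓ * x * y * (r : K) := by
      simpa using congrArg (Subtype.val : integralClosure ℤ K → K) hr
    have : σ (x + y) - (x + y) ^ ℓ = (σ x - x ^ ℓ) + (σ y - y ^ ℓ) - ℓ * (x * y * r) := by
      rw [map_add, hr']
      ring
    rw [this]
    exact (ihx.add ihy).sub (IntDvd.mul_self_right _ ((hx'.mul hy').mul r.2))
  | mul x y hx hy ihx ihy =>
    have hx' := isIntegral_of_mem_adjoin hζ hx
    have hy' := isIntegral_of_mem_adjoin hζ hy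
    have : σ (x * y) - (x * y) ^ ℓ = (σ x - x ^ ℓ) * σ y + x ^ ℓ * (σ y - y ^ ℓ) := by
      rw [map_mul]
      ring
    rw [this]
    exact (ihx.mul_right (isIntegral_apply hy' σ)).add (ihy.mul_left (hx'.pow ℓ))

end Automorphisms

/-! ### Congruences for powers of `1 + r * n * b` -/

section Arithmetic

theorem exists_dvd_mul_add_one {p a : ℕ} (hp : 0 < p) (h : a.Coprime p) :
    ∃ j : ℕ, p ∣ a * j + 1 := by
  have := NeZero.of_pos hp
  refine ⟨(-(a : ZMod p)⁻¹).val, ?_⟩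
  rw [← ZMod.natCast_eq_zero_iff]
  push_cast
  rw [ZMod.natCast_val, ZMod.cast_id', id, mul_neg, ZMod.coe_mul_inv_eq_one a h, neg_add_cancel]

theorem one_add_pow_modEq (r n b i : ℕ) :
    (1 + r * n * b) ^ i ≡ 1 + i * (r * n * b) [MOD r ^ 2 * n] := by
  induction i with
  | zero => simp [Nat.ModEq.refl]
  | succ i ih =>
    rw [pow_succ]
    refine (ih.mul_right _).trans ?_
    have : (1 + i * (r * n * b)) * (1 + r * n * b) =
        1 + (i + 1) * (r * n * b) + r ^ 2 * n * (i * n * b ^ 2) := by ring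
    rw [this]
    exact (Nat.modEq_iff_dvd' (Nat.le_add_right _ _)).2 (by simp) |>.symm

theorem one_add_pow_self_modEq (r n b : ℕ) : (1 + r * n * b) ^ r ≡ 1 [MOD r ^ 2 * n] := by
  refine (one_add_pow_modEq r n b r).trans ?_
  refine ((Nat.modEq_iff_dvd' (Nat.le_add_right _ _)).2 ?_).symm
  exact ⟨b, by rw [Nat.add_sub_cancel_left]; ring⟩

/-- Oddness of `r` makes `r` divide `0 + 1 + ⋯ + (r - 1)`, which kills the linear term; for `r = 2`
this fails. -/
theorem sum_one_add_pow_modEq {r : ℕ} (hr : Odd r) (n b : ℕ) :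
    ∑ i ∈ Finset.range r, (1 + r * n * b) ^ i ≡ r [MOD r ^ 2 * n] := by
  have h1 : ∑ i ∈ Finset.range r, (1 + r * n * b) ^ i ≡
      ∑ i ∈ Finset.range r, (1 + i * (r * n * b)) [MOD r ^ 2 * n] := by
    rw [← ZMod.natCast_eq_natCast_iff]
    push_cast
    refine Finset.sum_congr rfl fun i _ => ?_
    have := (ZMod.natCast_eq_natCast_iff _ _ _).2 (one_add_pow_modEq r n b i)
    exact_mod_cast this
  refine h1.trans ?_
  obtain ⟨k, hk⟩ := hr
  have h2 : ∑ i ∈ Finset.range r, i = r * k := by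
    rw [Finset.sum_range_id, hk]
    simp only [Nat.add_sub_cancel]
    rw [show (2 * k + 1) * (2 * k) = 2 * ((2 * k + 1) * k) by ring, Nat.mul_div_cancel_left _ two_pos]
  rw [Finset.sum_add_distrib, ← Finset.sum_mul, h2]
  simp only [Finset.sum_const, Finset.card_range, smul_eq_mul, mul_one]
  refine ((Nat.modEq_iff_dvd' (Nat.le_add_right _ _)).2 ?_).symm
  exact ⟨k * b, by rw [Nat.add_sub_cancel_left]; ring⟩

end Arithmetic

/-! ### Roots of unity of `K` and root-of-unity eigenvalues -/

section Roots

variable {K : Type*} [Field K] [NumberField K] {M : ℕ} [NeZero M] [IsCyclotomicExtension {M} ℚ K]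

variable (M) in
theorem pow_two_mul_eq_one {u : K} {n : ℕ} (hn : 0 < n) (hu : u ^ n = 1) : u ^ (2 * M) = 1 := by
  have h := IsPrimitiveRoot.orderOf u
  have hpos : orderOf u ≠ 0 :=
    (isOfFinOrder_iff_pow_eq_one.2 ⟨n, hn, hu⟩).orderOf_pos.ne'
  exact orderOf_dvd_iff_pow_eq_one.1 (h.dvd_of_isCyclotomicExtension M hpos)

/-- Up to sign, a root of unity of order dividing `2 * N` has order dividing `N`. -/
theorem exists_sign_of_pow_eq_one {k N : ℕ} (hM : M = k * N) (hk : Odd k) {u : K}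
    (hu : u ^ (2 * N) = 1) : ∃ ε v : K, (ε = 1 ∨ ε = -1) ∧ v ^ N = 1 ∧ u = ε * v := by
  have hN : 0 < N := Nat.pos_of_ne_zero (by rintro rfl; exact NeZero.ne M (by simpa using hM))
  rcases Nat.even_or_odd M with hM2 | hM2
  · refine ⟨1, u, Or.inl rfl, ?_, (one_mul u).symm⟩
    have h := IsPrimitiveRoot.orderOf u
    have hpos : orderOf u ≠ 0 :=
      (isOfFinOrder_iff_pow_eq_one.2 ⟨_, by positivity, hu⟩).orderOf_pos.ne'
    have : NeZero (orderOf u) := ⟨hpos⟩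
    have h1 := NumberField.Units.dvd_torsionOrder_of_isPrimitiveRoot h
    rw [IsCyclotomicExtension.Rat.torsionOrder_eq (n := M), if_pos hM2, hM] at h1
    -- For even `M` the torsion of `K` has order `M = k * N`, so the order of `u` divides `gcd (k *
    -- N) (2 * N) = N`, `k` being odd.
    have h2 : orderOf u ∣ 2 * N := orderOf_dvd_iff_pow_eq_one.2 hu
    have h3 := Nat.dvd_gcd h1 h2
    rw [Nat.gcd_mul_right, (Nat.coprime_two_right.2 hk : Nat.gcd k 2 = 1), one_mul] at h3
    exact orderOf_dvd_iff_pow_eq_one.1 h3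
  · have hNodd : Odd N := by
      rw [hM, Nat.odd_mul] at hM2
      exact hM2.2
    rw [mul_comm, pow_mul] at hu
    rcases eq_or_eq_neg_of_sq_eq_sq _ _ (hu.trans (one_pow 2).symm) with hu | hu
    · exact ⟨1, u, Or.inl rfl, hu, (one_mul u).symm⟩
    · exact ⟨-1, -u, Or.inr rfl, by rw [hNodd.neg_pow, hu, neg_neg], by ring⟩

end Roots

section Eigen

variable {K : Type*} [Field K] [CharZero K] {σ : K ≃ₐ[ℚ] K} {α u : K}

theorem exists_aut_pow_apply_eq {n : ℕ} (h : σ α = u * α) (hu : u ^ n = 1) (k : ℕ) :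
    ∃ v : K, v ^ n = 1 ∧ (σ ^ k) α = v * α := by
  induction k with
  | zero => exact ⟨1, one_pow n, by simp⟩
  | succ k ih =>
    obtain ⟨v, hv, hvα⟩ := ih
    refine ⟨(σ ^ k) u * v, ?_, ?_⟩
    · rw [mul_pow, hv, ← map_pow, hu, map_one, mul_one]
    · rw [pow_succ, AlgEquiv.mul_apply, h, map_mul, hvα, mul_assoc]

theorem aut_pow_apply_of_sign {ε v : K} (hε : ε = 1 ∨ ε = -1) {x : ℕ} (hv : σ v = v ^ x)
    (h : σ α = ε * v * α) (k : ℕ) :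
    (σ ^ k) α = ε ^ k * v ^ (∑ i ∈ Finset.range k, x ^ i) * α := by
  induction k with
  | zero => simp
  | succ k ih =>
    have hσε : σ ε = ε := by rcases hε with rfl | rfl <;> simp
    rw [pow_succ', AlgEquiv.mul_apply, ih, map_mul, map_mul, map_pow, map_pow, hσε, hv, h,
      Finset.sum_range_succ', ← pow_mul, pow_zero, pow_add]
    simp_rw [pow_succ' x, ← Finset.mul_sum]
    ring

end Eigen

/-- Replacing `α` by `w * α` multiplies the eigenvalue by `w ^ (ℓ - 1)`. The obstruction `u ^ (2 *
N)` is a `p`-th root of unity, and a suitable power of it serves as `w` since `2 * N * (ℓ - 1)` is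
invertible modulo `p`. -/
theorem exists_mul_root_aut_apply_eq {K : Type*} [Field K] [CharZero K] {M : ℕ} [NeZero M] {ζ : K}
    (hζ : IsPrimitiveRoot ζ M) {p N ℓ : ℕ} (hp : 0 < p)
    (hM : M = p * N) (hcop : (2 * N * (ℓ - 1)).Coprime p) (hℓ : 0 < ℓ) {σ : K ≃ₐ[ℚ] K}
    (hσ : σ ζ = ζ ^ ℓ) {α u : K} (hu : u ^ (2 * M) = 1) (h : σ α = u * α) :
    ∃ w v : K, w ^ (2 * M) = 1 ∧ v ^ (2 * N) = 1 ∧ σ (w * α) = v * (w * α) := by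
  obtain ⟨j, hj⟩ := exists_dvd_mul_add_one hp hcop
  set ε := u ^ (2 * N) with hε
  have hεp : ε ^ p = 1 := by rw [hε, ← pow_mul, ← hu, hM]; congr 1; ring
  have hw : (ε ^ j) ^ M = 1 := by rw [hM, pow_mul, pow_right_comm ε, hεp, one_pow, one_pow]
  refine ⟨ε ^ j, (ε ^ j) ^ (ℓ - 1) * u, ?_, ?_, ?_⟩
  · rw [mul_comm, pow_mul, hw, one_pow]
  · rw [mul_pow, ← hε, ← pow_mul, ← pow_mul, ← pow_succ]
    obtain ⟨t, ht⟩ := hj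
    rw [show j * ((ℓ - 1) * (2 * N)) + 1 = 2 * N * (ℓ - 1) * j + 1 by ring, ht, pow_mul, hεp, one_pow]
  · rw [map_mul, aut_apply_of_pow_eq_one hζ hσ hw, h]
    obtain ⟨ℓ, rfl⟩ := Nat.exists_eq_add_of_lt hℓ
    simp only [zero_add, Nat.add_sub_cancel]
    ring

/-! ### Descent from level `M` to level `M / r` -/

section Descent

theorem mem_adjoin_of_fixed {K : Type*} [Field K] [NumberField K] [IsGalois ℚ K]
    {x μ : K}
    (h : ∀ σ : K ≃ₐ[ℚ] K, σ μ = μ → σ x = x) : x ∈ IntermediateField.adjoin ℚ ({μ} : Set K) := by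
  rw [← IsGalois.fixedField_fixingSubgroup (IntermediateField.adjoin ℚ ({μ} : Set K))]
  rw [IntermediateField.mem_fixedField_iff]
  intro σ hσ
  refine h σ ?_
  rw [IntermediateField.mem_fixingSubgroup_iff] at hσ
  exact hσ μ (IntermediateField.mem_adjoin_simple_self ℚ μ)

variable {K : Type*} [Field K] [NumberField K] {M : ℕ} [NeZero M] [IsCyclotomicExtension {M} ℚ K]
  {ζ : K}

/-- An element which is an eigenvector, with a root of unity as eigenvalue, of an automorphism of
order `r` that acts as `x ↦ x ^ (1 + (N / r) * b)` on `N`-th roots of unity becomes invariant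
after multiplication with a root of unity. -/
theorem exists_mul_fixed (hζ : IsPrimitiveRoot ζ M) {r n b k N : ℕ} (hr : r.Prime) (hr2 : Odd r)
    (hM : M = k * N) (hk : Odd k) (hN : N = r ^ 2 * n) (hb : ¬ r ∣ b) {σ : K ≃ₐ[ℚ] K}
    (hσN : σ (ζ ^ k) = (ζ ^ k) ^ (1 + r * n * b)) (hσr : σ ^ r = 1) {α u : K} (hα : α ≠ 0)
    (hu : u ^ (2 * N) = 1) (h : σ α = u * α) : ∃ w : K, w ^ N = 1 ∧ σ (w * α) = w * α := by
  have hN0 : N ≠ 0 := by rintro rfl; exact NeZero.ne M (by simpa using hM)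
  have hζN : IsPrimitiveRoot (ζ ^ k) N := hζ.pow (NeZero.pos M) hM
  set μ := ζ ^ k with hμ
  have hact : ∀ v : K, v ^ N = 1 → σ v = v ^ (1 + r * n * b) := fun v hv => by
    have := NeZero.mk hN0
    exact aut_apply_of_pow_eq_one hζN hσN hv
  -- Iterating `σ α = u * α` and using `σ ^ r = 1` shows that the norm of `u` along `σ` is 1; by
  -- `sum_one_add_pow_modEq` this norm is just `u ^ r`.
  have hur : u ^ r = 1 := by
    obtain ⟨ε, v, hε, hv, rfl⟩ := exists_sign_of_pow_eq_one hM hk hu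
    have h1 := aut_pow_apply_of_sign hε (hact v hv) h r
    rw [hσr, AlgEquiv.one_apply] at h1
    have h2 : ε ^ r * v ^ r = 1 := by
      have h3 : v ^ (∑ i ∈ Finset.range r, (1 + r * n * b) ^ i) = v ^ r := by
        refine pow_eq_pow_of_modEq (sum_one_add_pow_modEq hr2 n b) ?_
        rw [← hN, hv]
      rw [h3] at h1
      exact mul_right_cancel₀ hα (by rw [← h1, one_mul])
    rw [mul_pow, h2]
  have hη : IsPrimitiveRoot (μ ^ (r * n * b)) r := by
    have h1 : IsPrimitiveRoot (μ ^ (r * n)) r :=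
      hζN.pow (Nat.pos_of_ne_zero hN0) (by rw [hN]; ring)
    rw [pow_mul]
    exact h1.pow_of_coprime b (((Nat.Prime.coprime_iff_not_dvd hr).2 hb).symm)
  have hu0 : u ≠ 0 := by
    rintro rfl
    simp [hr.ne_zero] at hur
  have := NeZero.mk hr.ne_zero
  -- `σ` multiplies `μ` by a primitive `r`-th root of unity, so some power of `μ` is multiplied by
  -- `u⁻¹` and compensates the eigenvalue.
  obtain ⟨j, -, hj⟩ := hη.eq_pow_of_pow_eq_one (ξ := u⁻¹) (by rw [inv_pow, hur, inv_one])
  refine ⟨μ ^ j, by rw [pow_right_comm, hζN.pow_eq_one, one_pow], ?_⟩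
  have : σ (μ ^ j) = μ ^ j * u⁻¹ := by
    rw [map_pow, hσN, pow_add, pow_one, mul_pow, hj]
  rw [map_mul, this, h]
  field_simp

theorem exists_mul_mem_adjoin_pow (hζ : IsPrimitiveRoot ζ M) {r n b : ℕ} (hr : r.Prime)
    (hr2 : Odd r) (hM : M = r ^ 2 * n) (hb : ¬ r ∣ b) {σ : K ≃ₐ[ℚ] K}
    (hσ : σ ζ = ζ ^ (1 + r * n * b)) {α u : K} (hα : α ≠ 0) (hu : u ^ (2 * M) = 1)
    (h : σ α = u * α) :
    ∃ w : K, w ^ M = 1 ∧ w * α ∈ IntermediateField.adjoin ℚ ({ζ ^ r} : Set K) := by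
  have hσr : σ ^ r = 1 := aut_ext hζ (by
    rw [aut_pow_apply hσ, AlgEquiv.one_apply]
    conv_rhs => rw [← pow_one ζ]
    refine pow_eq_pow_of_modEq (one_add_pow_self_modEq r n b) ?_
    rw [← hM, hζ.pow_eq_one])
  obtain ⟨w, hw, hwα⟩ := exists_mul_fixed hζ (k := 1) hr hr2 (by rw [one_mul]) odd_one hM hb
    (by simpa using hσ) hσr hα hu h
  have : IsGalois ℚ K := IsCyclotomicExtension.isGalois {M} ℚ K
  refine ⟨w, hw, mem_adjoin_of_fixed fun τ hτ => ?_⟩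
  have hζ0 : ζ ≠ 0 := hζ.ne_zero (NeZero.ne M)
  have hη : IsPrimitiveRoot (ζ ^ (r * n * b)) r := by
    have h1 : IsPrimitiveRoot (ζ ^ (r * n)) r :=
      hζ.pow (NeZero.pos M) (by rw [hM]; ring)
    rw [pow_mul]
    exact h1.pow_of_coprime b (((Nat.Prime.coprime_iff_not_dvd hr).2 hb).symm)
  set η := ζ ^ (r * n * b) with hηdef
  have hση : σ η = η := by
    rw [aut_apply_of_pow_eq_one hζ hσ (by rw [hηdef, pow_right_comm, hζ.pow_eq_one, one_pow]),
      pow_add, pow_one, mul_assoc, pow_mul, hη.pow_eq_one, one_pow, mul_one]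
  have hσk : ∀ j : ℕ, (σ ^ j) ζ = ζ * η ^ j := by
    intro j
    induction j with
    | zero => simp
    | succ j ih =>
      rw [pow_succ', AlgEquiv.mul_apply, ih, map_mul, map_pow, hση, hσ, pow_add, pow_one, pow_succ]
      ring
  have hε : (τ ζ / ζ) ^ r = 1 := by
    rw [div_pow, ← map_pow, hτ, div_self (pow_ne_zero r hζ0)]
  have := NeZero.mk hr.ne_zero
  obtain ⟨j, -, hj⟩ := hη.eq_pow_of_pow_eq_one hε
  -- An automorphism fixing `ζ ^ r` multiplies `ζ` by an `r`-th root of unity, and the powers of `σ`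
  -- realise all of these.
  have hτσ : τ = σ ^ j := aut_ext hζ (by rw [hσk, hj]; field_simp)
  rw [hτσ]
  clear hτσ hj
  induction j with
  | zero => simp
  | succ j ih => rw [pow_succ, AlgEquiv.mul_apply, hwα, ih]

end Descent

/-! ### Frobenius at `ℓ` and the eigenvalue equation -/

section Frobenius

variable {K : Type*} [Field K] [NumberField K] {M : ℕ} [NeZero M] [IsCyclotomicExtension {M} ℚ K]
  {ζ : K}

theorem pow_eq_one_of_mul_conj_eq_one (hζ : IsPrimitiveRoot ζ M) {c : K ≃ₐ[ℚ] K} (hc : c ζ = ζ⁻¹)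
    {x : K} (hx : IsIntegral ℤ x) (h : x * c x = 1) : x ^ (2 * M) = 1 := by
  obtain ⟨n, hn, hxn⟩ := NumberField.Embeddings.pow_eq_one_of_norm_eq_one K ℂ hx fun φ => by
    have := embedding_mul_conj hζ hc φ x
    rw [h, map_one] at this
    have h1 : ‖φ x‖ ^ 2 = 1 := by exact_mod_cast this.symm
    exact (pow_eq_one_iff_of_nonneg (norm_nonneg _) two_ne_zero).1 h1
  exact pow_two_mul_eq_one M hn hxn

/-- `ℓ` is unramified: `σ x ≡ x ^ ℓ ≡ 0` modulo `ℓ` for the Frobenius `σ`, and `σ` can be undone. -/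
theorem IntDvd.of_pow (hζ : IsPrimitiveRoot ζ M) {ℓ : ℕ} (hℓ : ℓ.Prime) (hM : ℓ.Coprime M) {x : K}
    (hx : IsIntegral ℤ x) (h : IntDvd (ℓ : K) (x ^ ℓ)) : IntDvd (ℓ : K) x := by
  obtain ⟨σ, hσ⟩ := exists_aut hζ hM
  have h1 : IntDvd (ℓ : K) (σ x) := by
    simpa using (intDvd_aut_sub_pow hζ hℓ hσ hx).add h
  simpa using h1.map σ.symm

theorem intDvd_aut_of_mul_conj_eq_self (hζ : IsPrimitiveRoot ζ M) {c : K ≃ₐ[ℚ] K}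
    {ℓ : ℕ} (hℓ : ℓ.Prime) {σ : K ≃ₐ[ℚ] K} (hσ : σ ζ = ζ ^ ℓ) {α : K} (hα : IsIntegral ℤ α)
    (h : α * c α = ℓ) : IntDvd α (σ α) := by
  have h1 : IntDvd α (ℓ : K) := ⟨c α, isIntegral_apply hα c, h.symm⟩
  have h2 : IntDvd α (α ^ ℓ) :=
    ⟨α ^ (ℓ - 1), hα.pow _, by rw [← pow_succ', Nat.sub_add_cancel hℓ.one_le]⟩
  simpa using (h1.trans (intDvd_aut_sub_pow hζ hℓ hσ hα)).add h2

/-- With `σ α = α ^ 2 + 2 * y` it suffices that `α` divides `2 * y`. If `y * c α = 2 * t`, then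
multiplying by `α` gives `4 * y = 2 * α * t`, which is the claim. The divisibility of `y * c α` by 2
follows from that of its fourth power, 2 being unramified. -/
theorem intDvd_aut_of_mul_conj_eq_four (hζ : IsPrimitiveRoot ζ M) {c : K ≃ₐ[ℚ] K}
    (hM : Nat.Coprime 2 M) {σ : K ≃ₐ[ℚ] K} (hσ : σ ζ = ζ ^ 2) {α : K} (hα : IsIntegral ℤ α)
    (h : α * c α = 4) : IntDvd α (σ α) := by
  obtain ⟨y, hy, hαy⟩ := intDvd_aut_sub_pow hζ Nat.prime_two hσ hα
  rw [Nat.cast_ofNat] at hαy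
  have hcα := isIntegral_apply hα c
  have hcy := isIntegral_apply hy c
  have h1 : σ α = α ^ 2 + 2 * y := by rw [← hαy]; ring
  have h2 : σ (c α) = c α ^ 2 + 2 * c y := by
    rw [aut_comm hζ, h1, map_add, map_pow, map_mul, map_ofNat]
  have h3 : σ α * σ (c α) = 4 := by rw [← map_mul, h, map_ofNat]
  rw [h1, h2] at h3
  have h4 : y * c α ^ 2 + c y * α ^ 2 = 2 * (-3 - y * c y) := by
    have : (2 : K) ≠ 0 := two_ne_zero
    refine mul_left_cancel₀ this ?_
    linear_combination h3 - (α * c α + 4) * h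
  -- Multiply the previous relation by `y ^ 3 * c α ^ 2`: its second term becomes a multiple of `(α
  -- * c α) ^ 2 = 16`, which is where the 8 in the witness comes from.
  have h5 : IntDvd ((2 : ℕ) : K) ((y * c α) ^ 4) := by
    refine ⟨y ^ 3 * ((-3 - y * c y) * c α ^ 2 - 8 * c y), ?_, ?_⟩
    · have h3' : IsIntegral ℤ (3 : K) := by simpa using isIntegral_natCast' (K := K) 3
      have h8' : IsIntegral ℤ (8 : K) := by simpa using isIntegral_natCast' (K := K) 8
      exact (hy.pow 3).mul (((h3'.neg.sub (hy.mul hcy)).mul (hcα.pow 2)).sub (h8'.mul hcy))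
    · push_cast
      linear_combination y ^ 3 * c α ^ 2 * h4 - y ^ 3 * c y * (α * c α + 4) * h
  have h6 : IntDvd ((2 : ℕ) : K) (y * c α) := by
    refine IntDvd.of_pow hζ Nat.prime_two hM (hy.mul hcα) ?_
    refine IntDvd.of_pow hζ Nat.prime_two hM ((hy.mul hcα).pow 2) ?_
    rwa [← pow_mul]
  obtain ⟨t, ht, hyt⟩ := h6
  refine ⟨α + t, hα.add ht, ?_⟩
  have : (4 : K) ≠ 0 := by norm_num
  refine mul_left_cancel₀ this ?_
  push_cast at hyt
  linear_combination 4 * h1 - 2 * y * h + 2 * α * hyt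

theorem exists_root_aut_apply_eq (hζ : IsPrimitiveRoot ζ M) {c : K ≃ₐ[ℚ] K} (hc : c ζ = ζ⁻¹)
    {σ : K ≃ₐ[ℚ] K} {α : K} {C : ℕ} (hC : C ≠ 0) (h : α * c α = C) (hd : IntDvd α (σ α)) :
    ∃ u : K, u ^ (2 * M) = 1 ∧ σ α = u * α := by
  obtain ⟨u, hu, huα⟩ := hd
  have hCK : (C : K) ≠ 0 := by exact_mod_cast hC
  refine ⟨u, pow_eq_one_of_mul_conj_eq_one hζ hc hu ?_, by rw [huα, mul_comm]⟩
  have h1 : σ α * σ (c α) = C := by rw [← map_mul, h, map_natCast]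
  rw [aut_comm hζ, huα, map_mul] at h1
  refine mul_left_cancel₀ hCK ?_
  linear_combination h1 - u * c u * h

end Frobenius

/-! ### Inertia at `p` and powers of `1 - ω` -/

section Ramification

variable {K : Type*} [Field K] {p : ℕ} {ω : K}

theorem IntDvd.of_mul_of_coprime (hp : p.Prime) (hω : IsPrimitiveRoot ω p) {k : ℤ}
    (hk : IsCoprime k (p : ℤ)) {y : K} (hy : IsIntegral ℤ y) (h : IntDvd (1 - ω) (k * y)) :
    IntDvd (1 - ω) y := by
  obtain ⟨a, b, hab⟩ := hk
  have h1 : IntDvd (1 - ω) (p : K) :=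
    IntDvd.one_sub_natCast hp.pos hω.pow_eq_one (hω.ne_one hp.one_lt)
  have h2 : y = a * (k * y) + p * (b * y) := by
    have := congrArg (Int.cast : ℤ → K) hab
    push_cast at this
    linear_combination -y * this
  rw [h2]
  exact (h.mul_left (isIntegral_intCast' a)).add
    (h1.mul_right ((isIntegral_intCast' b).mul hy))

/-- `1 - u` divides `n`, which is prime to `p`, so it can be cancelled modulo `1 - ω`. -/
theorem IntDvd.of_one_sub_root_mul (hp : p.Prime) (hω : IsPrimitiveRoot ω p) {u : K} {n : ℕ}
    (hn : 0 < n) (hpn : ¬ p ∣ n) (hu : u ^ n = 1) (hu1 : u ≠ 1) {y : K} (hy : IsIntegral ℤ y)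
    (h : IntDvd (1 - ω) ((1 - u) * y)) : IntDvd (1 - ω) y := by
  refine IntDvd.of_mul_of_coprime hp hω (k := n) ?_ hy ?_
  · exact (Nat.isCoprime_iff_coprime.2 ((Nat.Prime.coprime_iff_not_dvd hp).2 hpn)).symm
  · obtain ⟨z, hz, hnz⟩ := IntDvd.one_sub_natCast hn hu hu1
    have : ((n : ℤ) : K) * y = z * ((1 - u) * y) := by
      push_cast
      rw [hnz]
      ring
    rw [this]
    exact h.mul_left hz

/-- On the `a`-th graded piece of the `(1 - ω)`-adic filtration `s` acts as multiplication by `h ^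
a`. Where `h ^ a` is not 1 modulo `p`, a fixed element has leading coefficient zero. -/
theorem IntDvd.pow_succ_of_fixed [CharZero K] (hp : p.Prime) (hω : IsPrimitiveRoot ω p) {s : K ≃ₐ[ℚ] K}
    {h a : ℕ} (hs : ∀ x : K, IsIntegral ℤ x → IntDvd (1 - ω) (s x - x)) (hsω : s ω = ω ^ h)
    (ha : ¬ h ^ a ≡ 1 [MOD p]) {x : K} (hx : IntDvd ((1 - ω) ^ a) x) (hsx : s x = x) :
    IntDvd ((1 - ω) ^ (a + 1)) x := by
  obtain ⟨y, hy, rfl⟩ := hx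
  have hωi : IsIntegral ℤ ω := isIntegral_of_pow_eq_one hp.pos hω.pow_eq_one
  have hπ : (1 - ω) ≠ 0 := sub_ne_zero.2 (hω.ne_one hp.one_lt).symm
  set g : K := ∑ i ∈ Finset.range h, ω ^ i with hg
  have hgi : IsIntegral ℤ g := IsIntegral.sum _ fun i _ => hωi.pow i
  have hsπ : s (1 - ω) = (1 - ω) * g := by
    rw [map_sub, map_one, hsω, hg]
    linear_combination geom_sum_mul ω h
  have h1 : g ^ a * s y = y := by
    rw [map_mul, map_pow, hsπ] at hsx
    refine mul_left_cancel₀ (pow_ne_zero a hπ) ?_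
    rw [← hsx, mul_pow]
    ring
  have hgh : IntDvd (1 - ω) ((h : K) - g) := by
    have : (h : K) - g = ∑ i ∈ Finset.range h, (1 - ω ^ i) := by
      rw [Finset.sum_sub_distrib]
      simp [hg]
    rw [this]
    exact IntDvd.sum fun i _ => IntDvd.one_sub_pow hωi i
  have hgha : IntDvd (1 - ω) ((h : K) ^ a - g ^ a) := by
    rw [← (Commute.all (h : K) g).mul_geom_sum₂]
    exact hgh.mul_right (IsIntegral.sum _ fun i _ =>
      ((isIntegral_natCast' h).pow _).mul (hgi.pow _))
  have key : IntDvd (1 - ω) (((h : ℤ) ^ a - 1 : ℤ) * y) := by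
    have : (((h : ℤ) ^ a - 1 : ℤ) : K) * y = ((h : K) ^ a - g ^ a) * y - g ^ a * (s y - y) := by
      push_cast
      linear_combination h1
    rw [this]
    exact (hgha.mul_right hy).sub ((hs y hy).mul_left (hgi.pow a))
  have hy' : IntDvd (1 - ω) y := by
    refine IntDvd.of_mul_of_coprime hp hω ?_ hy key
    rw [isCoprime_comm, Prime.coprime_iff_not_dvd (Nat.prime_iff_prime_int.1 hp)]
    intro hdvd
    refine ha ?_
    have : ((h ^ a : ℕ) : ℤ) ≡ ((1 : ℕ) : ℤ) [ZMOD p] := by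
      push_cast
      exact ((Int.modEq_iff_dvd).2 hdvd).symm
    exact Int.natCast_modEq_iff.1 this
  obtain ⟨z, hz, rfl⟩ := hy'
  exact ⟨z, hz, by ring⟩

theorem IntDvd.pow_of_fixed [CharZero K] (hp : p.Prime) (hω : IsPrimitiveRoot ω p) {s : K ≃ₐ[ℚ] K}
    {h r : ℕ} (hr : 0 < r) (hs : ∀ x : K, IsIntegral ℤ x → IntDvd (1 - ω) (s x - x))
    (hsω : s ω = ω ^ h) (hord : ∀ a, 0 < a → a < r → ¬ h ^ a ≡ 1 [MOD p]) {x : K}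
    (hx : IntDvd (1 - ω) x) (hsx : s x = x) : IntDvd ((1 - ω) ^ r) x := by
  have : ∀ a, a < r → IntDvd ((1 - ω) ^ (a + 1)) x := by
    intro a
    induction a with
    | zero => exact fun _ => by simpa using hx
    | succ a ih =>
      intro ha
      exact IntDvd.pow_succ_of_fixed hp hω hs hsω (hord _ a.succ_pos ha) (ih (by omega)) hsx
  obtain ⟨r, rfl⟩ := Nat.exists_eq_add_of_lt hr
  simpa using this r (by omega)

end Ramification

/-! ### Eigencomponents under an automorphism of order `r` -/

section EigenComponents

variable {K : Type*} [Field K] {η : K} {r : ℕ}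

theorem sum_pow_mul_inv_pow (hη : IsPrimitiveRoot η r) {j l : ℕ} (hj : j < r) (hl : l < r) :
    ∑ i ∈ Finset.range r, (η ^ l * (η⁻¹) ^ j) ^ i = if l = j then (r : K) else 0 := by
  have hη0 : η ≠ 0 := hη.ne_zero (by omega)
  split_ifs with h
  · rw [h, ← mul_pow, mul_inv_cancel₀ hη0]
    simp
  · set x := η ^ l * (η⁻¹) ^ j with hx
    have hx1 : x ≠ 1 := by
      intro hx1
      rw [hx, inv_pow, mul_inv_eq_one₀ (pow_ne_zero j hη0)] at hx1
      exact h (hη.pow_inj hl hj hx1)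
    have hxr : x ^ r = 1 := by
      rw [hx, mul_pow, pow_right_comm, hη.pow_eq_one, one_pow, inv_pow, inv_pow, pow_right_comm,
        hη.pow_eq_one, one_pow, inv_one, one_mul]
    have := geom_sum_mul x r
    rw [hxr, sub_self, mul_eq_zero] at this
    exact this.resolve_right (sub_ne_zero.2 hx1)

variable [NumberField K]

/-- The projection of `x` to the `η ^ i`-eigenspace of an automorphism `τ` of order `r`. -/
noncomputable def eigenPart (τ : K ≃ₐ[ℚ] K) (η : K) (r i : ℕ) (x : K) : K :=
  (r : K)⁻¹ * ∑ j ∈ Finset.range r, (η⁻¹) ^ (i * j) * (τ ^ j) x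

variable {τ : K ≃ₐ[ℚ] K}

theorem aut_eigenPart (hr : r ≠ 0) (hη : IsPrimitiveRoot η r) (hτη : τ η = η) (hτr : τ ^ r = 1)
    (i : ℕ) (x : K) : τ (eigenPart τ η r i x) = η ^ i * eigenPart τ η r i x := by
  have hη0 : η ≠ 0 := hη.ne_zero hr
  have h1 : ∑ j ∈ Finset.range r, (η⁻¹) ^ (i * j) * (τ ^ j) x =
      ∑ j ∈ Finset.range r, (η⁻¹) ^ (i * (j + 1)) * (τ ^ (j + 1)) x := by
    have h2 := Finset.sum_range_succ (fun j => (η⁻¹) ^ (i * j) * (τ ^ j) x) r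
    rw [Finset.sum_range_succ'] at h2
    have h3 : (η⁻¹) ^ (i * r) = 1 := by
      rw [mul_comm, pow_mul, inv_pow, hη.pow_eq_one, inv_one, one_pow]
    simp only [hτr, h3, mul_zero, pow_zero] at h2
    exact (add_right_cancel h2).symm
  simp only [eigenPart]
  rw [map_mul, map_inv₀, map_natCast, map_sum]
  conv_rhs => rw [h1]
  rw [mul_left_comm, Finset.mul_sum (a := η ^ i)]
  congr 1
  refine Finset.sum_congr rfl fun j _ => ?_
  rw [map_mul, map_pow, map_inv₀, hτη, pow_succ', AlgEquiv.mul_apply, mul_add, mul_one, pow_add,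
    inv_pow η i]
  field_simp

theorem aut_eigenPart_of_comm {s : K ≃ₐ[ℚ] K} (hs : ∀ x, s (τ x) = τ (s x)) (hsη : s η = η)
    (i : ℕ) (x : K) : s (eigenPart τ η r i x) = eigenPart τ η r i (s x) := by
  have hsj : ∀ j : ℕ, ∀ x, s ((τ ^ j) x) = (τ ^ j) (s x) := by
    intro j
    induction j with
    | zero => simp
    | succ j ih =>
      intro x
      rw [pow_succ, AlgEquiv.mul_apply, AlgEquiv.mul_apply, ih, hs]
  simp only [eigenPart]
  rw [map_mul, map_inv₀, map_natCast, map_sum]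
  congr 1
  refine Finset.sum_congr rfl fun j _ => ?_
  rw [map_mul, map_pow, map_inv₀, hsη, hsj]

theorem sum_eigenPart (hr : r ≠ 0) (hη : IsPrimitiveRoot η r) (x : K) :
    ∑ i ∈ Finset.range r, eigenPart τ η r i x = x := by
  have hrK : (r : K) ≠ 0 := by exact_mod_cast hr
  simp only [eigenPart]
  rw [← Finset.mul_sum, Finset.sum_comm]
  have : ∀ j ∈ Finset.range r, ∑ i ∈ Finset.range r, (η⁻¹) ^ (i * j) * (τ ^ j) x =
      if j = 0 then r * x else 0 := by
    intro j hj
    rw [← Finset.sum_mul]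
    have := sum_pow_mul_inv_pow hη (Finset.mem_range.1 hj) (Nat.pos_of_ne_zero hr)
    simp only [pow_zero, one_mul, ← pow_mul] at this
    simp_rw [mul_comm _ j]
    rw [this]
    rcases eq_or_ne j 0 with rfl | h
    · simp
    · simp [h, h.symm]
  rw [Finset.sum_congr rfl this, Finset.sum_ite_eq' (Finset.range r) 0,
    if_pos (Finset.mem_range.2 (Nat.pos_of_ne_zero hr)), inv_mul_cancel_left₀ hrK]

/-- Parseval: the sum is the average of `(τ ^ j) (α * c α)` over `j`, and each of these is `C`. -/
theorem sum_eigenPart_mul_conj (hr : r ≠ 0) (hη : IsPrimitiveRoot η r) {c : K ≃ₐ[ℚ] K}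
    (hcτ : ∀ x, c (τ x) = τ (c x)) (hcη : c η = η⁻¹) {α : K} {C : ℕ} (h : α * c α = C) :
    ∑ i ∈ Finset.range r, eigenPart τ η r i α * c (eigenPart τ η r i α) = C := by
  have hrK : (r : K) ≠ 0 := by exact_mod_cast hr
  have hcj : ∀ j : ℕ, ∀ x, c ((τ ^ j) x) = (τ ^ j) (c x) := by
    intro j
    induction j with
    | zero => simp
    | succ j ih =>
      intro x
      rw [pow_succ, AlgEquiv.mul_apply, AlgEquiv.mul_apply, ih, hcτ]
  have h1 : ∀ i, eigenPart τ η r i α * c (eigenPart τ η r i α) =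
      (r : K)⁻¹ * (r : K)⁻¹ * ∑ j ∈ Finset.range r, ∑ l ∈ Finset.range r,
        (η ^ l * (η⁻¹) ^ j) ^ i * ((τ ^ j) α * (τ ^ l) (c α)) := by
    intro i
    simp only [eigenPart]
    rw [map_mul, map_inv₀, map_natCast, map_sum, mul_mul_mul_comm, Finset.sum_mul_sum]
    congr 1
    refine Finset.sum_congr rfl fun j _ => Finset.sum_congr rfl fun l _ => ?_
    rw [map_mul, map_pow, map_inv₀, hcη, inv_inv, hcj]
    ring
  have h2 : ∀ j ∈ Finset.range r, ∀ l ∈ Finset.range r,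
      ∑ i ∈ Finset.range r, (η ^ l * (η⁻¹) ^ j) ^ i * ((τ ^ j) α * (τ ^ l) (c α)) =
      if l = j then (r : K) * C else 0 := by
    intro j hj l hl
    rw [← Finset.sum_mul, sum_pow_mul_inv_pow hη (Finset.mem_range.1 hj) (Finset.mem_range.1 hl)]
    split_ifs with hlj
    · rw [hlj, ← map_mul, h, map_natCast]
    · rw [zero_mul]
  simp_rw [h1]
  rw [← Finset.mul_sum, Finset.sum_comm]
  have h3 : ∀ j ∈ Finset.range r, ∑ i ∈ Finset.range r, ∑ l ∈ Finset.range r,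
      (η ^ l * (η⁻¹) ^ j) ^ i * ((τ ^ j) α * (τ ^ l) (c α)) = (r : K) * C := by
    intro j hj
    rw [Finset.sum_comm, Finset.sum_congr rfl (h2 j hj), Finset.sum_ite_eq', if_pos hj]
  rw [Finset.sum_congr rfl h3, Finset.sum_const, Finset.card_range, nsmul_eq_mul]
  field_simp

/-- As `τ ζ = η * ζ`, the projection keeps the monomials `ζ ^ e` with `e ≡ i` modulo `r` and kills
the others, so the denominator `r` cancels. -/
theorem isIntegral_eigenPart {M : ℕ} [NeZero M] [IsCyclotomicExtension {M} ℚ K] {ζ : K}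
    (hζ : IsPrimitiveRoot ζ M) (hr : r ≠ 0) (hη : IsPrimitiveRoot η r)
    (hτη : τ η = η) (hτζ : τ ζ = η * ζ) (i : ℕ) (hi : i < r) {x : K} (hx : IsIntegral ℤ x) :
    IsIntegral ℤ (eigenPart τ η r i x) := by
  have hrK : (r : K) ≠ 0 := by exact_mod_cast hr
  have hη0 : η ≠ 0 := hη.ne_zero hr
  have hτj : ∀ j : ℕ, (τ ^ j) ζ = η ^ j * ζ := by
    intro j
    induction j with
    | zero => simp
    | succ j ih => rw [pow_succ', AlgEquiv.mul_apply, ih, map_mul, map_pow, hτη, hτζ]; ring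
  have hx' := mem_adjoin_of_isIntegral hζ hx
  clear hx
  rw [← Subalgebra.mem_toSubmodule, Algebra.adjoin_eq_span, ← Submonoid.powers_eq_closure] at hx'
  induction hx' using Submodule.span_induction with
  | mem x hx =>
    obtain ⟨e, rfl⟩ := hx
    have h1 : ∑ j ∈ Finset.range r, (η⁻¹) ^ (i * j) * (τ ^ j) (ζ ^ e) =
        ζ ^ e * (if e % r = i then (r : K) else 0) := by
      rw [← sum_pow_mul_inv_pow hη hi (Nat.mod_lt e (Nat.pos_of_ne_zero hr)), Finset.mul_sum]
      refine Finset.sum_congr rfl fun j _ => ?_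
      have : η ^ (e % r) = η ^ e := by
        conv_rhs => rw [← Nat.mod_add_div e r, pow_add, pow_mul, hη.pow_eq_one, one_pow, mul_one]
      rw [map_pow, hτj, this]
      ring
    simp only [eigenPart]
    rw [h1]
    split_ifs
    · rw [mul_comm (ζ ^ e), inv_mul_cancel_left₀ hrK]
      exact (hζ.isIntegral (NeZero.pos M)).pow e
    · simpa using isIntegral_zero
  | zero => simpa [eigenPart] using isIntegral_zero
  | add x y _ _ ihx ihy =>
    have : eigenPart τ η r i (x + y) = eigenPart τ η r i x + eigenPart τ η r i y := by
      simp only [eigenPart, map_add, mul_add, Finset.sum_add_distrib]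
    rw [this]
    exact ihx.add ihy
  | smul a x _ ih =>
    have : eigenPart τ η r i (a • x) = a * eigenPart τ η r i x := by
      simp only [eigenPart, zsmul_eq_mul, map_mul, map_intCast, Finset.mul_sum]
      refine Finset.sum_congr rfl fun j _ => ?_
      ring
    rw [this]
    exact (isIntegral_intCast' a).mul ih

end EigenComponents

/-! ### Elements fixed by a product of inertia elements at `p` and `r` -/

section Twisted

variable {K : Type*} [Field K] [NumberField K] {M : ℕ} [NeZero M] [IsCyclotomicExtension {M} ℚ K]
  {ζ : K}

/-- If `α` and its images `a + b`, `a + e * b`, `a + e ^ 2 * b` have the same absolute value,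
then `a` or `b` vanishes. -/
theorem eq_zero_or_eq_zero_of_rotations {K : Type*} [Field K] [CharZero K] {c τ : K ≃ₐ[ℚ] K}
    {e a b : K} {C : ℕ} (hcτ : ∀ x, c (τ x) = τ (c x)) (he0 : e ≠ 0) (he : e ≠ 1)
    (he2 : e ^ 2 ≠ 1) (hce : c e = e⁻¹) (hτe : τ e = e) (ha : τ a = a) (hb : τ b = e * b)
    (h : (a + b) * c (a + b) = C) : a = 0 ∨ b = 0 := by
  have h1 : (a + e * b) * (c a + e⁻¹ * c b) = C := by
    have := congrArg τ h
    rw [map_natCast, map_mul, map_add, ha, hb, ← hcτ, map_add τ, ha, hb, map_add, map_mul, hce]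
      at this
    exact this
  have h2 : (a + e ^ 2 * b) * (c a + (e⁻¹) ^ 2 * c b) = C := by
    have hca : τ (c a) = c a := by rw [← hcτ, ha]
    have hcb : τ (c b) = e⁻¹ * c b := by rw [← hcτ, hb, map_mul, hce]
    have := congrArg τ h1
    rw [map_natCast, map_mul, map_add, map_add, map_mul, map_mul, map_inv₀, ha, hb, hca, hcb,
      hτe] at this
    -- The remaining two identities compare cross terms: equality of the three absolute values gives
    -- `a * c b = e * (b * c a)` and `a * c b = e ^ 2 * (b * c a)`, incompatible unless `b * c a =
    -- 0`.
    rw [← this]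
    ring
  rw [map_add] at h
  have h3 : a * c b = e * (b * c a) := by
    have : (e - 1) * (a * c b) = (e - 1) * (e * (b * c a)) := by
      have h4 := h.trans h1.symm
      field_simp at h4
      linear_combination h4
    exact mul_left_cancel₀ (sub_ne_zero.2 he) this
  have h4 : a * c b = e ^ 2 * (b * c a) := by
    have : (e ^ 2 - 1) * (a * c b) = (e ^ 2 - 1) * (e ^ 2 * (b * c a)) := by
      have h4 := h.trans h2.symm
      field_simp at h4
      linear_combination h4
    exact mul_left_cancel₀ (sub_ne_zero.2 he2) this
  have h5 : e * (1 - e) * (b * c a) = 0 := by linear_combination h4 - h3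
  have h6 : b * c a = 0 := by
    refine (mul_eq_zero.1 h5).resolve_left (mul_ne_zero he0 (sub_ne_zero.2 he.symm))
  rcases mul_eq_zero.1 h6 with h | h
  · exact Or.inr h
  · exact Or.inl (by simpa using h)

/-- An element of bounded absolute value fixed by a product `s * τ`, with `s` ramified at `p`
and `τ` ramified at `r`, is an eigenvector of `τ`. -/
theorem exists_eigenvalue_of_fixed (hζ : IsPrimitiveRoot ζ M) {c : K ≃ₐ[ℚ] K} (hc : c ζ = ζ⁻¹)
    {p r h C : ℕ} (hp : p.Prime) (hpr : p = 2 * r + 1) (hr : r.Prime) (hr2 : Odd r) {ω η : K}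
    (hω : IsPrimitiveRoot ω p) (hη : IsPrimitiveRoot η r) (hrM : r ∣ M)
    {s τ : K ≃ₐ[ℚ] K} (hs : ∀ x : K, IsIntegral ℤ x → IntDvd (1 - ω) (s x - x))
    (hsω : s ω = ω ^ h) (hord : ∀ a, 0 < a → a < r → ¬ h ^ a ≡ 1 [MOD p])
    (hsη : s η = η) (hτη : τ η = η) (hτζ : τ ζ = η * ζ)
    {α : K} (hα : IsIntegral ℤ α) (hαC : α * c α = C) (hC : C ^ 2 < 4 * p)
    (hfix : s (τ α) = α) : ∃ u : K, u ^ r = 1 ∧ τ α = u * α := by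
  have hr0 := hr.ne_zero
  have hη0 : η ≠ 0 := hη.ne_zero hr0
  have hηM : η ^ M = 1 := by
    obtain ⟨t, rfl⟩ := hrM
    rw [pow_mul, hη.pow_eq_one, one_pow]
  have hcη : c η = η⁻¹ := by
    obtain ⟨k, -, rfl⟩ := hζ.eq_pow_of_pow_eq_one hηM
    rw [map_pow, hc, inv_pow]
  have hτr : τ ^ r = 1 := by
    have hτj : ∀ j : ℕ, (τ ^ j) ζ = η ^ j * ζ := by
      intro j
      induction j with
      | zero => simp
      | succ j ih => rw [pow_succ', AlgEquiv.mul_apply, ih, map_mul, map_pow, hτη, hτζ]; ring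
    exact aut_ext hζ (by rw [hτj, hη.pow_eq_one]; simp)
  set a : ℕ → K := fun i => eigenPart τ η r i α with ha
  have haτ : ∀ i, τ (a i) = η ^ i * a i := fun i => aut_eigenPart hr0 hη hτη hτr i α
  have hai : ∀ i, i < r → IsIntegral ℤ (a i) := fun i hi =>
    isIntegral_eigenPart hζ hr0 hη hτη hτζ i hi hα
  have hcai : ∀ i, i < r → IsIntegral ℤ (c (a i)) := fun i hi => isIntegral_apply (hai i hi) c
  have has : ∀ i, a i = η ^ i * s (a i) := by
    intro i
    have h1 : s (τ (a i)) = a i := by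
      simp only [ha]
      rw [aut_eigenPart_of_comm (s := τ) (fun x => rfl) hτη,
        aut_eigenPart_of_comm (fun x => aut_comm hζ s τ x) hsη, hfix]
    rw [haτ, map_mul, map_pow, hsη] at h1
    exact h1.symm
  have hsum : ∑ i ∈ Finset.range r, a i = α := sum_eigenPart hr0 hη α
  have hsumsq : ∑ i ∈ Finset.range r, a i * c (a i) = C :=
    sum_eigenPart_mul_conj hr0 hη (fun x => aut_comm hζ c τ x) hcη hαC
  -- Here `(1 - η ^ i) * a i` is a multiple of `s (a i) - a i`, hence divisible by `1 - ω`, and `1 -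
  -- η ^ i` is prime to `p`. The eigenvalues cancel in `a i * c (a i)`, which is thus fixed by `s`,
  -- and divisibility rises to the power `r`.
  have hπ : ∀ i, 0 < i → i < r → IntDvd ((1 - ω) ^ r) (a i * c (a i)) := by
    intro i hi hir
    refine IntDvd.pow_of_fixed hp hω hr.pos hs hsω hord ?_ ?_
    · refine IntDvd.mul_right ?_ (hcai i hir)
      have hη1 : η ^ i ≠ 1 := hη.pow_ne_one_of_pos_of_lt hi.ne' hir
      refine IntDvd.of_one_sub_root_mul hp hω hr.pos (u := η ^ i) ?_
        (by rw [pow_right_comm, hη.pow_eq_one, one_pow]) hη1 (hai i hir) ?_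
      · exact Nat.not_dvd_of_pos_of_lt hr.pos (by omega)
      · have : (1 - η ^ i) * a i = η ^ i * (s (a i) - a i) := by
          rw [mul_sub, ← has]
          ring
        rw [this]
        exact (hs _ (hai i hir)).mul_left
          ((isIntegral_of_pow_eq_one hr.pos hη.pow_eq_one).pow i)
    · have h1 : c (a i) = (η ^ i)⁻¹ * s (c (a i)) := by
        conv_lhs => rw [has i]
        rw [map_mul, map_pow, hcη, inv_pow, aut_comm hζ]
      have hηi : η ^ i ≠ 0 := pow_ne_zero i hη0
      calc s (a i * c (a i)) = (η ^ i * s (a i)) * ((η ^ i)⁻¹ * s (c (a i))) := by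
            rw [map_mul]
            field_simp
        _ = a i * c (a i) := by rw [← has, ← h1]
  -- The product of two such norms is divisible by `(1 - ω) ^ (2 * r)`, hence by `p`. Their sum is
  -- at most `C`, so their product is at most `C ^ 2 / 4 < p` in every embedding, and the quotient
  -- by `p` vanishes.
  have hpair : ∀ i k, 0 < i → i < r → 0 < k → k < r → i ≠ k → a i = 0 ∨ a k = 0 := by
    intro i k hi hir hk hkr hik
    have h1 := ((hπ i hi hir).mul (hπ k hk hkr))
    rw [← pow_add, show r + r = p - 1 by omega] at h1
    obtain ⟨z, hz, hz'⟩ := (IntDvd.natCast_one_sub_pow hp hω).trans h1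
    have hz0 : z = 0 := by
      refine eq_zero_of_norm_lt_one hz fun φ => ?_
      have e1 : ∑ l ∈ Finset.range r, ‖φ (a l)‖ ^ 2 = (C : ℝ) := by
        have := congrArg φ hsumsq
        rw [map_sum, map_natCast] at this
        simp_rw [embedding_mul_conj hζ hc φ] at this
        exact_mod_cast this
      have e2 : ‖φ (a i)‖ ^ 2 + ‖φ (a k)‖ ^ 2 ≤ C := by
        rw [← e1, ← Finset.sum_pair hik (f := fun l => ‖φ (a l)‖ ^ 2)]
        refine Finset.sum_le_sum_of_subset_of_nonneg ?_ fun _ _ _ => by positivity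
        intro l hl
        rw [Finset.mem_insert, Finset.mem_singleton] at hl
        rw [Finset.mem_range]
        rcases hl with rfl | rfl <;> assumption
      have e3 : ‖φ (a i)‖ ^ 2 * ‖φ (a k)‖ ^ 2 = p * ‖φ z‖ := by
        have := congrArg (fun x => ‖φ x‖) hz'
        simp only [map_mul φ (a i * c (a i)), embedding_mul_conj hζ hc φ, norm_mul, map_mul φ (p : K),
          map_natCast, Complex.norm_natCast] at this
        rw [← this, Complex.norm_of_nonneg (by positivity), Complex.norm_of_nonneg (by positivity)]
      have e4 : (C : ℝ) ^ 2 < 4 * p := by exact_mod_cast hC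
      have hp0 : (0 : ℝ) < p := by exact_mod_cast hp.pos
      have e5 : (p : ℝ) * ‖φ z‖ < p * 1 := by
        rw [← e3]
        nlinarith [sq_nonneg (‖φ (a i)‖ ^ 2 - ‖φ (a k)‖ ^ 2), sq_nonneg ‖φ (a i)‖,
          sq_nonneg ‖φ (a k)‖]
      exact lt_of_mul_lt_mul_left e5 hp0.le
    rw [hz0, mul_zero] at hz'
    rcases mul_eq_zero.1 hz' with h | h <;> rcases mul_eq_zero.1 h with h | h
    · exact Or.inl h
    · exact Or.inl (by simpa using h)
    · exact Or.inr h
    · exact Or.inr (by simpa using h)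
  have hr1 := hr.two_le
  obtain ⟨i, hi, hir, hik⟩ : ∃ i, 0 < i ∧ i < r ∧ ∀ k, 0 < k → k < r → k ≠ i → a k = 0 := by
    by_cases hex : ∃ i, 0 < i ∧ i < r ∧ a i ≠ 0
    · obtain ⟨i, hi, hir, hi0⟩ := hex
      exact ⟨i, hi, hir, fun k hk hkr hki =>
        (hpair i k hi hir hk hkr hki.symm).resolve_left hi0⟩
    · push Not at hex
      exact ⟨1, one_pos, by omega, fun k hk hkr _ => hex k hk hkr⟩
  have hαa : α = a 0 + a i := by
    rw [← hsum, ← Finset.sum_pair hi.ne]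
    symm
    refine Finset.sum_subset ?_ fun k hk hk' => ?_
    · intro l hl
      rw [Finset.mem_insert, Finset.mem_singleton] at hl
      rw [Finset.mem_range]
      rcases hl with rfl | rfl
      · exact hr.pos
      · exact hir
    · rw [Finset.mem_insert, Finset.mem_singleton, not_or] at hk'
      exact hik k (Nat.pos_of_ne_zero hk'.1) (Finset.mem_range.1 hk) hk'.2
  have ha0 : τ (a 0) = a 0 := by rw [haτ]; simp
  have he2 : (η ^ i) ^ 2 ≠ 1 := by
    rw [← pow_mul]
    intro h1
    exact Nat.not_dvd_of_pos_of_lt hi hir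
      ((Nat.coprime_two_right.2 hr2).dvd_of_dvd_mul_right ((hη.pow_eq_one_iff_dvd _).1 h1))
  rcases eq_zero_or_eq_zero_of_rotations (c := c) (τ := τ) (e := η ^ i) (a := a 0) (b := a i)
    (C := C) (fun x => aut_comm hζ c τ x) (pow_ne_zero i hη0)
    (hη.pow_ne_one_of_pos_of_lt hi.ne' hir) he2 (by rw [map_pow, hcη, inv_pow])
    (by rw [map_pow, hτη]) ha0 (haτ i) (by rw [← hαa, hαC]) with h0 | h0
  · refine ⟨η ^ i, by rw [pow_right_comm, hη.pow_eq_one, one_pow], ?_⟩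
    rw [hαa, h0, zero_add, haτ]
  · exact ⟨1, one_pow r, by rw [hαa, h0, add_zero, ha0, one_mul]⟩

end Twisted

/-! ### Gaussian periods for 7 and 11 -/

section Quadratic

theorem sum_range_pow_eq_zero {K : Type*} [Field K] {ω : K} {p : ℕ} (hω : IsPrimitiveRoot ω p)
    (hp : 1 < p) : ∑ i ∈ Finset.range p, ω ^ i = 0 := hω.geom_sum_eq_zero hp

variable {K : Type*} [Field K] [CharZero K] {ω : K}

theorem exists_half_sqrt_neg_seven (hω : IsPrimitiveRoot ω 7) :
    ∃ h : K, IsIntegral ℤ h ∧ h ^ 2 + h + 2 = 0 ∧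
      ∀ σ : K ≃ₐ[ℚ] K, σ ω = ω ^ 6 → σ h = -1 - h := by
  have hi : IsIntegral ℤ ω := hω.isIntegral (by norm_num)
  have h7 : ω ^ 7 = 1 := hω.pow_eq_one
  have h0 := sum_range_pow_eq_zero hω (by norm_num)
  simp only [Finset.sum_range_succ, Finset.sum_range_zero] at h0
  -- The exponents are the nonzero squares modulo 7; `-1` is not a square, so conjugation exchanges
  -- this period with the other one, and `2 * h + 1` is a square root of `-7`. The case of 11 is the
  -- same.
  refine ⟨ω + ω ^ 2 + ω ^ 4, (hi.add (hi.pow 2)).add (hi.pow 4), ?_, ?_⟩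
  · linear_combination 2 * h0 + ω * h7
  · intro σ hσ
    rw [map_add, map_add, map_pow, map_pow, hσ]
    linear_combination h0 + (ω ^ 5 + (ω ^ 17 + ω ^ 10 + ω ^ 3)) * h7

theorem exists_half_sqrt_neg_eleven (hω : IsPrimitiveRoot ω 11) :
    ∃ h : K, IsIntegral ℤ h ∧ h ^ 2 + h + 3 = 0 ∧
      ∀ σ : K ≃ₐ[ℚ] K, σ ω = ω ^ 10 → σ h = -1 - h := by
  have hi : IsIntegral ℤ ω := hω.isIntegral (by norm_num)
  have h11 : ω ^ 11 = 1 := hω.pow_eq_one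
  have hred : ∀ x : ℕ, ω ^ x = ω ^ (x % 11) := fun x => by
    conv_lhs => rw [← Nat.mod_add_div x 11, pow_add, pow_mul, h11, one_pow, mul_one]
  have h0 := sum_range_pow_eq_zero hω (by norm_num)
  simp only [Finset.sum_range_succ, Finset.sum_range_zero] at h0
  refine ⟨ω + ω ^ 3 + ω ^ 4 + ω ^ 5 + ω ^ 9,
    (((hi.add (hi.pow 3)).add (hi.pow 4)).add (hi.pow 5)).add (hi.pow 9), ?_, ?_⟩
  · have e12 := hred 12
    have e13 := hred 13
    have e14 := hred 14
    have e18 := hred 18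
    norm_num at e12 e13 e14 e18
    linear_combination 3 * h0 + 2 * e12 + 2 * e13 + 2 * e14 + e18
  · intro σ hσ
    simp only [map_add, map_pow, hσ, ← pow_mul]
    rw [hred (10 * 3), hred (10 * 4), hred (10 * 5), hred (10 * 9)]
    norm_num
    linear_combination h0

end Quadratic

/-! ### Fixed elements of inertia and the normal form `2α = B(A + δ)` -/

section Ramified

variable {K : Type*} [Field K] [NumberField K] {M : ℕ} [NeZero M] [IsCyclotomicExtension {M} ℚ K]
  {ζ : K}

/-- `s` is trivial modulo `1 - ω`, so an eigenvalue `u ≠ 1` of order prime to `p` would make `1 - ω`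
divide `α`, hence `C`, and then `p ∣ C`. -/
theorem eq_of_aut_ramified {K : Type*} [Field K] [CharZero K] {p n C : ℕ} (hp : p.Prime)
    {ω : K} (hω : IsPrimitiveRoot ω p) (hn : 0 < n) (hpn : ¬ p ∣ n) (hpC : ¬ p ∣ C)
    {s c : K ≃ₐ[ℚ] K} (hs : ∀ x : K, IsIntegral ℤ x → IntDvd (1 - ω) (s x - x)) {α u : K}
    (hα : IsIntegral ℤ α) (hαC : α * c α = C) (hu : u ^ n = 1) (h : s α = u * α) : s α = α := by
  by_cases hu1 : u = 1
  · rw [h, hu1, one_mul]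
  refine absurd (IntDvd.dvd_of_one_sub hp hω ?_) hpC
  rw [← hαC]
  refine IntDvd.mul_right ?_ (isIntegral_apply hα c)
  refine IntDvd.of_one_sub_root_mul hp hω hn hpn hu hu1 hα ?_
  have : (1 - u) * α = -(s α - α) := by rw [h]; ring
  rw [this]
  exact (hs α hα).neg

/-- The data attached to an integer `α` of constant absolute value fixed by the automorphism `s`
of order `(p - 1) / 2`: the difference of `α` and its conjugate over the quadratic subfield is
divisible by a square root of `p`. -/
theorem exists_conj_sub_eq (hζ : IsPrimitiveRoot ζ M) {c : K ≃ₐ[ℚ] K} (hc : c ζ = ζ⁻¹)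
    {p r h C : ℕ} (hp : p.Prime) (hpr : p = 2 * r + 1) (hr : 0 < r) {ω : K}
    (hω : IsPrimitiveRoot ω p) (hcω : c ω = ω⁻¹) {s κ : K ≃ₐ[ℚ] K}
    (hs : ∀ x : K, IsIntegral ℤ x → IntDvd (1 - ω) (s x - x))
    (hκ : ∀ x : K, IsIntegral ℤ x → IntDvd (1 - ω) (κ x - x))
    (hsω : s ω = ω ^ h) (hord : ∀ a, 0 < a → a < r → ¬ h ^ a ≡ 1 [MOD p])
    {α : K} (hα : IsIntegral ℤ α) (hαC : α * c α = C) (hsα : s α = α) :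
    (∃ β : K, IsIntegral ℤ β ∧ (α - κ α) * c (α - κ α) = p * β ∧
      ∀ φ : K →+* ℂ, ∃ x : ℝ, 0 ≤ x ∧ p * x ≤ 4 * C ∧ φ β = x) ∧
    IntDvd (p : K) ((α - κ α) ^ 2) := by
  have hωi : IsIntegral ℤ ω := hω.isIntegral hp.pos
  have hX1 : IntDvd (1 - ω) (α - κ α) := by
    rw [← neg_sub (κ α) α]
    exact (hκ α hα).neg
  have hX : IntDvd ((1 - ω) ^ r) (α - κ α) :=
    IntDvd.pow_of_fixed hp hω hr hs hsω hord hX1 (by rw [map_sub, aut_comm hζ s κ, hsα])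
  have hcX : IntDvd ((1 - ω) ^ r) (c (α - κ α)) := by
    refine IntDvd.trans ?_ (hX.map c)
    rw [map_pow, map_sub, map_one, hcω]
    refine IntDvd.pow ?_ r
    refine ⟨-ω⁻¹, ?_, ?_⟩
    · have : IsIntegral ℤ (ω⁻¹) := by
        rw [← hcω]
        exact isIntegral_apply hωi c
      exact this.neg
    · have := hω.ne_zero hp.ne_zero
      field_simp
      ring
  have hrr : r + r = p - 1 := by omega
  constructor
  · have h1 := hX.mul hcX
    rw [← pow_add, hrr] at h1
    obtain ⟨β, hβ, hβ'⟩ := (IntDvd.natCast_one_sub_pow hp hω).trans h1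
    refine ⟨β, hβ, hβ', fun φ => ?_⟩
    have hp0 : (0 : ℝ) < p := by exact_mod_cast hp.pos
    have e1 : ∀ y : K, y * c y = C → ‖φ y‖ ^ 2 = C := fun y hy => by
      have := embedding_mul_conj hζ hc φ y
      rw [hy, map_natCast] at this
      exact_mod_cast this.symm
    have e2 := e1 α hαC
    have e3 := e1 (κ α) (by rw [aut_comm hζ c κ, ← map_mul, hαC, map_natCast])
    -- The parallelogram law, both `α` and `κ α` having absolute value `√C`, is the source of the
    -- bound `4 * C / p`.
    have e4 : ‖φ (α - κ α)‖ ^ 2 + ‖φ α + φ (κ α)‖ ^ 2 = 4 * C := by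
      have := parallelogram_law_with_norm ℝ (φ α) (φ (κ α))
      rw [map_sub]
      nlinarith
    have e5 : φ (p * β) = ((‖φ (α - κ α)‖ ^ 2 : ℝ) : ℂ) := by
      rw [← hβ', embedding_mul_conj hζ hc]
    refine ⟨‖φ (α - κ α)‖ ^ 2 / p, by positivity, ?_, ?_⟩
    · rw [mul_div_cancel₀ _ hp0.ne']
      nlinarith [sq_nonneg ‖φ α + φ (κ α)‖]
    · rw [map_mul, map_natCast] at e5
      have hpC : (p : ℂ) ≠ 0 := by exact_mod_cast hp.ne_zero
      push_cast at e5 ⊢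
      rw [← e5, mul_div_cancel_left₀ _ hpC]
  · have h1 := hX.mul hX
    rw [← pow_add, hrr, ← sq] at h1
    exact (IntDvd.natCast_one_sub_pow hp hω).trans h1

/-- Normal form of `α` in terms of a square root `δ` of `-p`. -/
theorem exists_normal_form {K : Type*} [Field K] [CharZero K] {c κ : K ≃ₐ[ℚ] K}
    (hcκ : ∀ x, c (κ x) = κ (c x)) {p C : ℕ} {δ α β : K} (hp : p ≠ 0)
    (hδ : δ ^ 2 = -p) (hcδ : c δ = -δ) (hαC : α * c α = C)
    (hβ : (α - κ α) * c (α - κ α) = p * β) (hX : IntDvd (p : K) ((α - κ α) ^ 2))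
    (hβ0 : β ≠ 0) :
    ∃ A B : K, IsIntegral ℤ B ∧ B * c B = β ∧ 2 * α = B * (A + δ) ∧ β * (A ^ 2 + p) = 4 * C := by
  have hpK : (p : K) ≠ 0 := by exact_mod_cast hp
  have hδ0 : δ ≠ 0 := by
    rintro rfl
    simp [hp] at hδ
  have hX0 : α - κ α ≠ 0 := by
    intro h
    rw [h, zero_mul] at hβ
    exact mul_ne_zero hpK hβ0 hβ.symm
  set B := (α - κ α) / δ with hB
  have hB0 : B ≠ 0 := div_ne_zero hX0 hδ0
  have hBδ : B * δ = α - κ α := div_mul_cancel₀ _ hδ0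
  set A := (α + κ α) / B with hA
  have hAB : A * B = α + κ α := div_mul_cancel₀ _ hB0
  have hBB : B * c B = β := by
    have h1 : B * δ * c (B * δ) = p * β := by rw [hBδ, hβ]
    rw [map_mul, hcδ] at h1
    refine mul_left_cancel₀ hpK ?_
    linear_combination h1 + B * c B * hδ
  have hα2 : 2 * α = B * (A + δ) := by linear_combination -hAB - hBδ
  have hκα2 : 2 * κ α = B * (A - δ) := by linear_combination -hAB + hBδ
  have e1 : B * (A + δ) * (c B * (c A - δ)) = 4 * C := by
    have : c (2 * α) = c B * (c A - δ) := by rw [hα2, map_mul, map_add, hcδ]; ring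
    rw [← this, ← hα2, map_mul, map_ofNat]
    linear_combination 4 * hαC
  have e2 : B * (A - δ) * (c B * (c A + δ)) = 4 * C := by
    have : c (2 * κ α) = c B * (c A + δ) := by rw [hκα2, map_mul, map_sub, hcδ]; ring
    rw [← this, ← hκα2, map_mul, map_ofNat, hcκ]
    have h5 : κ α * κ (c α) = C := by rw [← map_mul, hαC, map_natCast]
    linear_combination 4 * h5
  -- `A` is real because `A + δ` and `A - δ` have the same absolute value, that of `2α / B` and `2κα
  -- / B`, with `δ` purely imaginary.
  have hcA : c A = A := by
    have h6 : 2 * (β * δ) * (c A - A) = 0 := by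
      linear_combination e1 - e2 - 2 * δ * (c A - A) * hBB
    have h7 : (2 : K) * (β * δ) ≠ 0 := mul_ne_zero two_ne_zero (mul_ne_zero hβ0 hδ0)
    exact sub_eq_zero.1 ((mul_eq_zero.1 h6).resolve_left h7)
  refine ⟨A, B, ?_, hBB, hα2, ?_⟩
  · obtain ⟨y, hy, hXy⟩ := hX
    refine IsIntegral.of_pow (n := 2) two_pos ?_
    have : B ^ 2 = -y := by
      rw [← hBδ, mul_pow, hδ] at hXy
      refine mul_left_cancel₀ hpK ?_
      linear_combination -hXy
    rw [this]
    exact hy.neg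
  · rw [hcA] at e1
    linear_combination e1 - (A ^ 2 - δ ^ 2) * hBB + β * hδ

end Ramified

/-! ### Totally positive integers with small conjugates -/

section SmallTotallyPositive

variable {K : Type*} [Field K] [NumberField K]

theorem eq_one_of_embeddings {β : K} (hβ : IsIntegral ℤ β) (hβ0 : β ≠ 0)
    (h : ∀ φ : K →+* ℂ, ∃ x : ℝ, 0 ≤ x ∧ x < 2 ∧ φ β = x) : β = 1 := by
  refine sub_eq_zero.1 (eq_zero_of_norm_lt_one (hβ.sub isIntegral_one) fun φ => ?_)
  obtain ⟨x, hx0, hx2, hx⟩ := h φ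
  have hx0' : x ≠ 0 := by
    rintro rfl
    refine hβ0 (φ.injective ?_)
    rw [hx, map_zero, Complex.ofReal_zero]
  rw [map_sub, map_one, hx, ← Complex.ofReal_one, ← Complex.ofReal_sub, Complex.norm_real,
    Real.norm_eq_abs, abs_lt]
  have := lt_of_le_of_ne hx0 hx0'.symm
  constructor <;> linarith

/-- An auxiliary polynomial with integer coefficients of absolute value below 1 on `[0, 20/7]`: it
must vanish at any algebraic integer with all conjugates there. The bound `20/7` is `4 * C / p` for
`C = 5`, `p = 7`. -/
theorem auxiliary_polynomial_lt_one {x : ℝ} (h0 : 0 ≤ x) (h1 : 7 * x ≤ 20) :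
    |x * ((x - 1) * (x - 2)) ^ 2 * (x ^ 2 - 3 * x + 1) ^ 4| < 1 := by
  set q := x ^ 2 - 3 * x + 1 with hq
  have e : x * ((x - 1) * (x - 2)) ^ 2 * q ^ 4 = x * (q ^ 2 * (q + 1)) ^ 2 := by
    rw [hq]
    ring
  rw [e, abs_of_nonneg (by positivity)]
  -- Near 0 the factor `x` does the work. On the rest `q` ranges between `-5/4` (at `x = 3/2`) and
  -- `29/49` (at `x = 20/7`), where `q ^ 2 * (q + 1)` is small.
  rcases lt_or_ge x (1 / 5) with hx | hx
  · have hq0 : 0 ≤ q := by nlinarith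
    have hq1 : q ≤ 1 := by nlinarith
    have h2 : q ^ 2 * (q + 1) ≤ 1 * 2 := by
      refine mul_le_mul (by nlinarith) (by linarith) (by linarith) one_pos.le
    have h3 : (q ^ 2 * (q + 1)) ^ 2 ≤ 4 := by
      have : 0 ≤ q ^ 2 * (q + 1) := by positivity
      nlinarith
    nlinarith
  · have hq0 : -(5 / 4) ≤ q := by nlinarith [sq_nonneg (x - 3 / 2)]
    have hq1 : q ≤ 29 / 49 := by nlinarith
    have h2 : q ^ 2 * (q + 1) ≤ 29 / 50 := by
      nlinarith [mul_nonneg (sub_nonneg.2 hq1) (sq_nonneg (q + 2 / 5)), sq_nonneg q,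
        sq_nonneg (q + 1)]
    have h3 : -(29 / 50) ≤ q ^ 2 * (q + 1) := by
      nlinarith [mul_nonneg (sub_nonneg.2 hq0) (sq_nonneg q), sq_nonneg q]
    have h4 : (q ^ 2 * (q + 1)) ^ 2 ≤ (29 / 50) ^ 2 := sq_le_sq' h3 h2
    nlinarith [sq_nonneg (q ^ 2 * (q + 1))]

theorem eq_one_or_eq_two_of_embeddings {β : K} (hβ : IsIntegral ℤ β) (hβ0 : β ≠ 0)
    (h : ∀ φ : K →+* ℂ, ∃ x : ℝ, 0 ≤ x ∧ 7 * x ≤ 20 ∧ φ β = x) :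
    β = 1 ∨ β = 2 ∨ β ^ 2 - 3 * β + 1 = 0 := by
  have h2 : IsIntegral ℤ (2 : K) := by simpa using isIntegral_natCast' (K := K) 2
  have h3 : IsIntegral ℤ (3 : K) := by simpa using isIntegral_natCast' (K := K) 3
  have key : β * ((β - 1) * (β - 2)) ^ 2 * (β ^ 2 - 3 * β + 1) ^ 4 = 0 := by
    refine eq_zero_of_norm_lt_one ?_ fun φ => ?_
    · exact (hβ.mul (((hβ.sub isIntegral_one).mul (hβ.sub h2)).pow 2)).mul
        ((((hβ.pow 2).sub (h3.mul hβ)).add isIntegral_one).pow 4)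
    · obtain ⟨x, hx0, hx1, hx⟩ := h φ
      have : φ (β * ((β - 1) * (β - 2)) ^ 2 * (β ^ 2 - 3 * β + 1) ^ 4) =
          ((x * ((x - 1) * (x - 2)) ^ 2 * (x ^ 2 - 3 * x + 1) ^ 4 : ℝ) : ℂ) := by
        simp only [map_mul, map_pow, map_sub, map_add, map_one, map_ofNat, hx]
        push_cast
        ring
      rw [this, Complex.norm_real, Real.norm_eq_abs]
      exact auxiliary_polynomial_lt_one hx0 hx1
  simp only [mul_eq_zero, pow_eq_zero_iff, hβ0, false_or, ne_eq, OfNat.ofNat_ne_zero,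
    not_false_eq_true, sub_eq_zero] at key
  rcases key with (h | h) | h
  · exact Or.inl h
  · exact Or.inr (Or.inl h)
  · exact Or.inr (Or.inr h)

end SmallTotallyPositive

/-! ### Excluding `√5` and treating `β = 2` -/

section Unramified

variable {K : Type*} [Field K] [NumberField K] {M : ℕ} [NeZero M] [IsCyclotomicExtension {M} ℚ K]
  {ζ : K}

/-- A root would give a square root `D = 2 * β - 3` of 5 in `K`. As 5 is unramified, 5 divides `D`
because it divides `D ^ 5`, and `D ^ 2 = 5` becomes absurd. -/
theorem ne_golden (hζ : IsPrimitiveRoot ζ M) (hM : Nat.Coprime 5 M) {β : K}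
    (hβ : IsIntegral ℤ β) : β ^ 2 - 3 * β + 1 ≠ 0 := by
  intro h
  have h2 : IsIntegral ℤ (2 : K) := by simpa using isIntegral_natCast' (K := K) 2
  have h3 : IsIntegral ℤ (3 : K) := by simpa using isIntegral_natCast' (K := K) 3
  have hD : (2 * β - 3) ^ 2 = 5 := by linear_combination 4 * h
  have hDi : IsIntegral ℤ (2 * β - 3) := (h2.mul hβ).sub h3
  set D := 2 * β - 3
  have h5 : IntDvd ((5 : ℕ) : K) D := by
    refine IntDvd.of_pow hζ Nat.prime_five hM hDi ?_
    refine ⟨5 * D, IsIntegral.mul (by simpa using isIntegral_natCast' (K := K) 5) hDi, ?_⟩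
    push_cast
    linear_combination (D ^ 3 + 5 * D) * hD
  obtain ⟨y, hy, hDy⟩ := h5
  have h1 : IntDvd ((5 : ℕ) : K) ((1 : ℕ) : K) := by
    refine ⟨y ^ 2, hy.pow 2, ?_⟩
    have : (5 : K) ≠ 0 := by norm_num
    refine mul_left_cancel₀ this ?_
    push_cast at hDy ⊢
    linear_combination -hD + (D + 5 * y) * hDy
  have := h1.dvd_of_natCast (by norm_num)
  norm_num at this

theorem pow_eq_one_of_sq_three (hζ : IsPrimitiveRoot ζ M) {c : K ≃ₐ[ℚ] K} (hc : c ζ = ζ⁻¹)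
    {α h A B : K} (hα : IsIntegral ℤ α) (hh : IsIntegral ℤ h) (hB : IsIntegral ℤ B)
    (hA : A ^ 2 = 3) (hBB : B * c B = 2) (hαB : 2 * α = B * (A + (2 * h + 1))) :
    ∃ u : K, u ^ (2 * M) = 1 ∧ B ^ 2 = 2 * u := by
  have h2 : IsIntegral ℤ (2 : K) := by simpa using isIntegral_natCast' (K := K) 2
  have h3 : IsIntegral ℤ (3 : K) := by simpa using isIntegral_natCast' (K := K) 3
  have hAi : IsIntegral ℤ A := IsIntegral.of_pow (n := 2) two_pos (hA ▸ h3)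
  have h20 : (2 : K) ≠ 0 := two_ne_zero
  have h40 : (4 : K) ≠ 0 := by norm_num
  -- From `2 * (α - h * B) = B * (A + 1)`: square it and use `(A + 1) ^ 2 = 2 * (2 + A)` together
  -- with the unit relation `(2 + A) * (2 - A) = 1`.
  have hF : B ^ 2 = 2 * ((α - h * B) ^ 2 * (2 - A)) := by
    have h1 : 2 * (α - h * B) = B * (A + 1) := by linear_combination hαB
    refine mul_left_cancel₀ h20 ?_
    linear_combination -(2 - A) * (2 * (α - h * B) + B * (A + 1)) * h1 + B ^ 2 * A * hA
  refine ⟨(α - h * B) ^ 2 * (2 - A), ?_, hF⟩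
  refine pow_eq_one_of_mul_conj_eq_one hζ hc (((hα.sub (hh.mul hB)).pow 2).mul (h2.sub hAi)) ?_
  set u := (α - h * B) ^ 2 * (2 - A)
  have h5 : B ^ 2 * c (B ^ 2) = 2 * u * c (2 * u) := by rw [hF]
  rw [map_pow, map_mul, map_ofNat] at h5
  refine mul_left_cancel₀ h40 ?_
  linear_combination -h5 + (B * c B + 2) * hBB

end Unramified

/-! ### Complex roots of unity and reduction up to equivalence -/

theorem isPrimitiveRoot_zeta {n : ℕ} (hn : n ≠ 0) : IsPrimitiveRoot (zeta n) n :=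
  Complex.isPrimitiveRoot_exp n hn

namespace IsRootOfOne

variable {z w : ℂ}

theorem one : IsRootOfOne 1 := ⟨1, one_pos, one_pow 1⟩

theorem mul (hz : IsRootOfOne z) (hw : IsRootOfOne w) : IsRootOfOne (z * w) := by
  obtain ⟨m, hm, hzm⟩ := hz
  obtain ⟨n, hn, hwn⟩ := hw
  exact ⟨m * n, Nat.mul_pos hm hn, by
    rw [mul_pow, pow_mul, hzm, one_pow, mul_comm m, pow_mul, hwn, one_pow, one_mul]⟩

theorem inv (hz : IsRootOfOne z) : IsRootOfOne z⁻¹ := by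
  obtain ⟨m, hm, hzm⟩ := hz
  exact ⟨m, hm, by rw [inv_pow, hzm, inv_one]⟩

theorem neg (hz : IsRootOfOne z) : IsRootOfOne (-z) := by
  rw [neg_eq_neg_one_mul]
  exact IsRootOfOne.mul ⟨2, two_pos, by norm_num⟩ hz

theorem conj (hz : IsRootOfOne z) : IsRootOfOne ((starRingEnd ℂ) z) := by
  obtain ⟨m, hm, hzm⟩ := hz
  exact ⟨m, hm, by rw [← map_pow, hzm, map_one]⟩

theorem ne_zero (hz : IsRootOfOne z) : z ≠ 0 := by
  obtain ⟨m, hm, hzm⟩ := hz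
  rintro rfl
  simp [hm.ne'] at hzm

theorem of_pow {n : ℕ} (hn : 0 < n) (hz : IsRootOfOne (z ^ n)) : IsRootOfOne z := by
  obtain ⟨m, hm, hzm⟩ := hz
  exact ⟨n * m, Nat.mul_pos hn hm, by rw [pow_mul, hzm]⟩

theorem zeta_pow {n : ℕ} (hn : n ≠ 0) (k : ℕ) : IsRootOfOne (zeta n ^ k) :=
  ⟨n, Nat.pos_of_ne_zero hn, by
    rw [pow_right_comm, (isPrimitiveRoot_zeta hn).pow_eq_one, one_pow]⟩

theorem conj_eq_inv (hz : IsRootOfOne z) : (starRingEnd ℂ) z = z⁻¹ := by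
  obtain ⟨m, hm, hzm⟩ := hz
  exact (Complex.inv_eq_conj (Complex.norm_eq_one_of_pow_eq_one hzm hm.ne')).symm

end IsRootOfOne

/-- Up to a root of unity, `α` lies in `ℚ(ζ_N)`, or it is an entry of the table or the complex
conjugate of one. -/
def Reducible (N : ℕ) (α : ℂ) : Prop :=
  ∃ u : ℂ, IsRootOfOne u ∧ (u * α ∈ cycloField N ∨ u * α ∈ exceptional ∨
    (starRingEnd ℂ) (u * α) ∈ exceptional)

theorem Reducible.of_mul {N : ℕ} {α w : ℂ} (hw : IsRootOfOne w) (h : Reducible N (w * α)) :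
    Reducible N α := by
  obtain ⟨u, hu, h⟩ := h
  rw [← mul_assoc] at h
  exact ⟨u * w, hu.mul hw, h⟩

theorem Reducible.covered_or {N : ℕ} {α : ℂ} (h : Reducible N α) :
    Covered α ∨ ∃ β ∈ cycloField N, Equivalent α β := by
  obtain ⟨u, hu, h | h | h⟩ := h
  · exact Or.inr ⟨_, h, u, α, hu, IsConjRoot.refl, rfl⟩
  · exact Or.inl (Or.inr (Or.inr (Or.inr ⟨_, h, u, α, hu, IsConjRoot.refl, rfl⟩)))
  · refine Or.inl (Or.inr (Or.inr (Or.inr ⟨_, h, (starRingEnd ℂ) u, (starRingEnd ℂ) α, hu.conj,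
      ?_, map_mul _ _ _⟩)))
    exact isConjRoot_of_algEquiv α (Complex.conjAe.restrictScalars ℚ)

/-! ### Identification with entries of the table -/

section Table

theorem conj_eq_self_of_sq {z : ℂ} {a : ℕ} (ha : a ≠ 0) (h : z ^ 2 = a) :
    (starRingEnd ℂ) z = z := by
  have h1 : (starRingEnd ℂ) z ^ 2 = z ^ 2 := by rw [← map_pow, h, map_natCast]
  rcases eq_or_eq_neg_of_sq_eq_sq _ _ h1 with h2 | h2
  · exact h2
  · exfalso
    have h3 : z.re = 0 := by
      have := congrArg Complex.re h2
      simp only [Complex.conj_re, Complex.neg_re] at this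
      linarith
    have h4 := congrArg Complex.re h
    simp only [sq, Complex.mul_re, h3, Complex.natCast_re] at h4
    have : (0 : ℝ) < a := by exact_mod_cast Nat.pos_of_ne_zero ha
    nlinarith [mul_self_nonneg z.im]

theorem conj_eq_neg_of_sq {z : ℂ} {a : ℕ} (ha : a ≠ 0) (h : z ^ 2 = -a) :
    (starRingEnd ℂ) z = -z := by
  have h1 : (Complex.I * z) ^ 2 = a := by rw [mul_pow, h, Complex.I_sq]; ring
  have h2 := conj_eq_self_of_sq ha h1
  rw [map_mul, Complex.conj_I] at h2
  have : Complex.I * ((starRingEnd ℂ) z + z) = 0 := by linear_combination -h2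
  exact eq_neg_of_add_eq_zero_left ((mul_eq_zero.1 this).resolve_left Complex.I_ne_zero)

/-- The squares determine `A` and `δ` only up to sign. A common sign is a root of unity; a relative
sign is complex conjugation, which fixes `A₀`, negates `δ₀` and changes `ε` by the root of unity
`ρ`. -/
theorem reducible_of_exceptional {N a d : ℕ} (ha : a ≠ 0) (hd : d ≠ 0)
    {θ ω ε ρ A₀ δ₀ α u A δ : ℂ} (hθ : θ ∈ exceptional) (hω : IsRootOfOne ω)
    (hρ : IsRootOfOne ρ) (hε : (starRingEnd ℂ) ε = ρ * ε) (hA₀ : A₀ ^ 2 = a) (hδ₀ : δ₀ ^ 2 = -d)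
    (hθe : 2 * θ = ω * ε * (A₀ + δ₀)) (hu : IsRootOfOne u) (hA : A ^ 2 = a) (hδ : δ ^ 2 = -d)
    (hα : 2 * α = u * ε * (A + δ)) : Reducible N α := by
  have hAA : A = A₀ ∨ A = -A₀ := eq_or_eq_neg_of_sq_eq_sq _ _ (hA.trans hA₀.symm)
  have hδδ : δ = δ₀ ∨ δ = -δ₀ := eq_or_eq_neg_of_sq_eq_sq _ _ (hδ.trans hδ₀.symm)
  have hu0 := hu.ne_zero
  have h20 : (2 : ℂ) ≠ 0 := two_ne_zero
  have hdirect : ∀ v : ℂ, IsRootOfOne v → 2 * α = v * ε * (A₀ + δ₀) → Reducible N α := by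
    intro v hv h
    have hv0 := hv.ne_zero
    refine ⟨ω * v⁻¹, hω.mul hv.inv, Or.inr (Or.inl ?_)⟩
    convert hθ using 1
    refine mul_left_cancel₀ h20 ?_
    rw [hθe, mul_left_comm, h]
    field_simp
  have hconj : ∀ v : ℂ, IsRootOfOne v → 2 * α = v * ε * (A₀ - δ₀) → Reducible N α := by
    intro v hv h
    have hv0 := hv.ne_zero
    have hρ0 := hρ.ne_zero
    refine ⟨(starRingEnd ℂ) (ω * ρ⁻¹) * v⁻¹, (hω.mul hρ.inv).conj.mul hv.inv, Or.inr (Or.inr ?_)⟩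
    convert hθ using 1
    refine mul_left_cancel₀ h20 ?_
    have h1 := congrArg (starRingEnd ℂ) h
    rw [map_mul, map_mul, map_mul, map_sub, conj_eq_self_of_sq ha hA₀, conj_eq_neg_of_sq hd hδ₀, hε,
      hv.conj_eq_inv, map_ofNat] at h1
    rw [hθe, map_mul, map_mul, Complex.conj_conj, map_inv₀, hv.conj_eq_inv, inv_inv, mul_left_comm,
      h1]
    field_simp
    ring
  rcases hAA with rfl | rfl <;> rcases hδδ with rfl | rfl
  · exact hdirect u hu hα
  · exact hconj u hu (by rw [hα]; ring)
  · exact hconj (-u) hu.neg (by rw [hα]; ring)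
  · exact hdirect (-u) hu.neg (by rw [hα]; ring)

theorem sum_zeta_pow_eq_zero {n k q : ℕ} (hn : n ≠ 0) (hq : 1 < q) (h : n = k * q) :
    ∑ i ∈ Finset.range q, (zeta n ^ k) ^ i = 0 :=
  sum_range_pow_eq_zero ((isPrimitiveRoot_zeta hn).pow (Nat.pos_of_ne_zero hn) h) hq

variable {N : ℕ} {α u A δ : ℂ}

theorem reducible_of_sq_five_eleven (hu : IsRootOfOne u) (hA : A ^ 2 = 5) (hδ : δ ^ 2 = -11)
    (hα : 2 * α = u * (A + δ)) : Reducible N α := by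
  have hn : zeta 55 ^ 55 = 1 := (isPrimitiveRoot_zeta (by norm_num)).pow_eq_one
  have ha := sum_zeta_pow_eq_zero (n := 55) (k := 11) (q := 5) (by norm_num) (by norm_num) rfl
  have hb := sum_zeta_pow_eq_zero (n := 55) (k := 5) (q := 11) (by norm_num) (by norm_num) rfl
  simp only [Finset.sum_range_succ, Finset.sum_range_zero] at ha hb
  refine reducible_of_exceptional (a := 5) (d := 11) (by norm_num) (by norm_num)
    (θ := 1 - zeta 55 - zeta 55 ^ 16 + zeta 55 ^ 22 - zeta 55 ^ 26 - zeta 55 ^ 31 - zeta 55 ^ 36)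
    (ω := zeta 55 ^ 11) (ε := 1) (ρ := 1)
    -- Both are quadratic Gauss sums, `√5` and (with a sign) `√-11`; `ω` undoes the rotation by
    -- which the table entry differs from `(A₀ + δ₀) / 2`.
    (A₀ := 1 + 2 * zeta 55 ^ 11 + 2 * zeta 55 ^ 44)
    (δ₀ := -(1 + 2 * zeta 55 ^ 5 + 2 * zeta 55 ^ 15 + 2 * zeta 55 ^ 20 + 2 * zeta 55 ^ 25
      + 2 * zeta 55 ^ 45))
    (by simp [exceptional]) (IsRootOfOne.zeta_pow (by norm_num) 11) IsRootOfOne.one (by simp)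
    ?_ ?_ ?_ hu (by simpa using hA) (by simpa using hδ) (by rw [hα]; ring)
  all_goals
    generalize zeta 55 = ζ at *
    push_cast
  · linear_combination 4 * ha + (8 + 4 * ζ ^ 33) * hn
  · linear_combination 12 * hb + (8 * ζ ^ 5 + 8 * ζ ^ 10 + 8 * ζ ^ 15 + 4 * ζ ^ 35) * hn
  · linear_combination (-2 + 2 * ζ) * hn

theorem reducible_of_sq_nine_eleven (hu : IsRootOfOne u) (hA : A ^ 2 = 9) (hδ : δ ^ 2 = -11)
    (hα : 2 * α = u * (A + δ)) : Reducible N α := by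
  have hn : zeta 11 ^ 11 = 1 := (isPrimitiveRoot_zeta (by norm_num)).pow_eq_one
  have ha := sum_zeta_pow_eq_zero (n := 11) (k := 1) (q := 11) (by norm_num) (by norm_num) rfl
  simp only [Finset.sum_range_succ, Finset.sum_range_zero] at ha
  refine reducible_of_exceptional (a := 9) (d := 11) (by norm_num) (by norm_num)
    (θ := 1 + zeta 11 + zeta 11 ^ 2 + zeta 11 ^ 4 - zeta 11 ^ 5 + zeta 11 ^ 7)
    (ω := zeta 11 ^ 5) (ε := 1) (ρ := 1) (A₀ := -3)
    (δ₀ := -(1 + 2 * zeta 11 + 2 * zeta 11 ^ 3 + 2 * zeta 11 ^ 4 + 2 * zeta 11 ^ 5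
      + 2 * zeta 11 ^ 9))
    (by simp [exceptional]) (IsRootOfOne.zeta_pow (by norm_num) 5) IsRootOfOne.one (by simp)
    (by norm_num) ?_ ?_ hu (by simpa using hA) (by simpa using hδ) (by rw [hα]; ring)
  all_goals
    generalize zeta 11 = ζ at *
    push_cast
  · linear_combination 12 * ha + (8 * ζ + 8 * ζ ^ 2 + 8 * ζ ^ 3 + 4 * ζ ^ 7) * hn
  · linear_combination 2 * ha + 2 * ζ ^ 3 * hn

theorem reducible_of_sq_thirteen_seven (hu : IsRootOfOne u) (hA : A ^ 2 = 13) (hδ : δ ^ 2 = -7)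
    (hα : 2 * α = u * (A + δ)) : Reducible N α := by
  have hn : zeta 91 ^ 91 = 1 := (isPrimitiveRoot_zeta (by norm_num)).pow_eq_one
  have ha := sum_zeta_pow_eq_zero (n := 91) (k := 7) (q := 13) (by norm_num) (by norm_num) rfl
  have hb := sum_zeta_pow_eq_zero (n := 91) (k := 13) (q := 7) (by norm_num) (by norm_num) rfl
  simp only [Finset.sum_range_succ, Finset.sum_range_zero] at ha hb
  refine reducible_of_exceptional (a := 13) (d := 7) (by norm_num) (by norm_num)
    (θ := 1 + zeta 91 ^ 7 + zeta 91 ^ 14 - zeta 91 ^ 17 + zeta 91 ^ 21 + zeta 91 ^ 42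
      - zeta 91 ^ 69 + zeta 91 ^ 70 - zeta 91 ^ 82)
    (ω := zeta 91 ^ 56) (ε := 1) (ρ := 1)
    (A₀ := -(1 + 2 * zeta 91 ^ 7 + 2 * zeta 91 ^ 21 + 2 * zeta 91 ^ 28 + 2 * zeta 91 ^ 63
      + 2 * zeta 91 ^ 70 + 2 * zeta 91 ^ 84))
    (δ₀ := -(1 + 2 * zeta 91 ^ 13 + 2 * zeta 91 ^ 26 + 2 * zeta 91 ^ 52))
    (by simp [exceptional]) (IsRootOfOne.zeta_pow (by norm_num) 56) IsRootOfOne.one (by simp)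
    ?_ ?_ ?_ hu (by simpa using hA) (by simpa using hδ) (by rw [hα]; ring)
  all_goals
    generalize zeta 91 = ζ at *
    push_cast
  · linear_combination 12 * ha + (24 + 8 * ζ ^ 7 + 8 * ζ ^ 14 + 8 * ζ ^ 21 + 4 * ζ ^ 35
      + 8 * ζ ^ 42 + 4 * ζ ^ 49 + 8 * ζ ^ 56 + 8 * ζ ^ 63 + 4 * ζ ^ 77) * hn
  · linear_combination 8 * hb + 4 * ζ ^ 13 * hn
  · linear_combination 2 * ha + (2 * ζ ^ 17 + 2 * ζ ^ 28 + 2 * ζ ^ 35 + 2 * ζ ^ 49) * hn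

theorem reducible_of_sq_three_seven {B : ℂ} (hu : IsRootOfOne u) (hB : B ^ 2 = 2 * u)
    (hA : A ^ 2 = 3) (hδ : δ ^ 2 = -7) (hα : 2 * α = B * (A + δ)) : Reducible N α := by
  have hn : zeta 84 ^ 84 = 1 := (isPrimitiveRoot_zeta (by norm_num)).pow_eq_one
  have hb := sum_zeta_pow_eq_zero (n := 84) (k := 28) (q := 3) (by norm_num) (by norm_num) rfl
  have hc := sum_zeta_pow_eq_zero (n := 84) (k := 12) (q := 7) (by norm_num) (by norm_num) rfl
  simp only [Finset.sum_range_succ, Finset.sum_range_zero] at hb hc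
  have ha : 1 + zeta 84 ^ 42 = 0 := by
    have h2 : IsPrimitiveRoot (zeta 84 ^ 42) 2 :=
      (isPrimitiveRoot_zeta (by norm_num)).pow (by norm_num) rfl
    rw [h2.eq_neg_one_of_two_right]
    norm_num
  have hi : IsRootOfOne (zeta 84 ^ 21) := IsRootOfOne.zeta_pow (by norm_num) 21
  have hi2 : (zeta 84 ^ 21) ^ 2 = -1 := by linear_combination ha
  have hi0 := hi.ne_zero
  have hε0 : 1 + zeta 84 ^ 21 ≠ 0 := by
    intro h
    have h1 : zeta 84 ^ 21 = -1 := by linear_combination h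
    rw [h1] at hi2
    norm_num at hi2
  -- `zeta 84 ^ 21` is `i`, and `(1 + i) ^ 2 = 2 * i` matches `B ^ 2 = 2 * u`, so `B` is `1 + i` up
  -- to a root of unity.
  have hw : IsRootOfOne (B / (1 + zeta 84 ^ 21)) := by
    refine IsRootOfOne.of_pow (n := 2) two_pos ?_
    have : (B / (1 + zeta 84 ^ 21)) ^ 2 = u * (zeta 84 ^ 21)⁻¹ := by
      rw [div_pow, hB, show (1 + zeta 84 ^ 21) ^ 2 = 2 * zeta 84 ^ 21 by linear_combination hi2]
      field_simp
    rw [this]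
    exact hu.mul hi.inv
  refine reducible_of_exceptional (a := 3) (d := 7) (by norm_num) (by norm_num)
    (θ := 1 - zeta 84 ^ 4 - zeta 84 ^ 13 - zeta 84 ^ 16 + zeta 84 ^ 19 + zeta 84 ^ 21
      + zeta 84 ^ 22 + zeta 84 ^ 31)
    (ω := zeta 84 ^ 7) (ε := 1 + zeta 84 ^ 21) (ρ := (zeta 84 ^ 21)⁻¹)
    (A₀ := -zeta 84 ^ 21 - 2 * zeta 84 ^ 49)
    (δ₀ := 1 + 2 * zeta 84 ^ 12 + 2 * zeta 84 ^ 24 + 2 * zeta 84 ^ 48)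
    (by simp [exceptional]) (IsRootOfOne.zeta_pow (by norm_num) 7) hi.inv ?_
    ?_ ?_ ?_ hw (by simpa using hA) (by simpa using hδ)
    (by rw [hα, div_mul_cancel₀ _ hε0])
  · rw [map_add, map_one, hi.conj_eq_inv, mul_add, mul_one, inv_mul_cancel₀ hi0, add_comm]
  all_goals
    clear hw hB hi hi2 hi0 hε0
    generalize zeta 84 = ζ at *
    push_cast
  · linear_combination (1 + 4 * ζ ^ 28 + 4 * ζ ^ 56) * ha - 4 * hb
  · linear_combination 8 * hc + 4 * ζ ^ 12 * hn
  · linear_combination (-2 * ζ ^ 13 - ζ ^ 49 + 2 * ζ ^ 64) * ha + (2 + 2 * ζ ^ 21) * hb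
      - 2 * ζ ^ 28 * hc + (2 * ζ ^ 4 + ζ ^ 7 + 2 * ζ ^ 16 - 2 * ζ ^ 22) * hn

end Table

/-! ### Choice of the power of `ℓ` and its arithmetic -/

/-- If `y ^ r ≡ 1` modulo `N` and `y ≡ 1` modulo every prime factor of `N`, but not modulo `N`, then
`r ^ 2 ∣ N` and `y - 1` is `N / r` times a number not divisible by `r`. -/
theorem exists_eq_one_add_mul {r N y : ℕ} (hr : r.Prime) (hr2 : Odd r) (hN : 0 < N) (hy : 0 < y)
    (hyr : y ^ r ≡ 1 [MOD N]) (hq : ∀ q : ℕ, q.Prime → q ∣ N → y ≡ 1 [MOD q])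
    (hyN : ¬ y ≡ 1 [MOD N]) : ∃ n b : ℕ, N = r ^ 2 * n ∧ y = 1 + r * n * b ∧ ¬ r ∣ b := by
  set S := ∑ i ∈ Finset.range r, y ^ i with hS
  have hmul : (y - 1) * S = y ^ r - 1 := by
    have h1 : 1 ≤ y ^ r := Nat.one_le_pow _ _ hy
    zify [hy, h1]
    rw [hS]
    push_cast
    exact mul_geom_sum (y : ℤ) r
  have hdvd : N ∣ (y - 1) * S := by
    rw [hmul]
    exact (Nat.modEq_iff_dvd' (Nat.one_le_pow _ _ hy)).1 hyr.symm
  have hSq : ∀ q : ℕ, q.Prime → q ∣ N → S ≡ r [MOD q] := by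
    intro q hqp hqN
    have : S ≡ ∑ i ∈ Finset.range r, 1 [MOD q] := by
      rw [hS, ← ZMod.natCast_eq_natCast_iff]
      push_cast
      refine Finset.sum_congr rfl fun i _ => ?_
      have := (ZMod.natCast_eq_natCast_iff _ _ _).2 (hq q hqp hqN)
      rw [this]
      simp
    simpa using this
  have hny : ¬ N ∣ y - 1 := fun h => hyN ((Nat.modEq_iff_dvd' hy).2 h).symm
  -- A prime `q ∣ N` sharing a factor with the geometric sum `S ≡ r` must be `r`. Without `r` in
  -- `N`, all of `N` would divide `y - 1`.
  have hrN : r ∣ N := by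
    by_contra hrN
    refine hny (Nat.Coprime.dvd_of_dvd_mul_right ?_ hdvd)
    refine Nat.Coprime.symm (Nat.coprime_of_dvd fun q hqp hqS hqN => hrN ?_)
    have h1 : q ∣ r := ((hSq q hqp hqN).dvd_iff dvd_rfl).1 hqS
    rwa [← (Nat.prime_dvd_prime_iff_eq hqp hr).1 h1]
  obtain ⟨t, ht⟩ : r ∣ y - 1 := (Nat.modEq_iff_dvd' hy).1 (hq r hr hrN).symm
  have hyt : y = 1 + r * 1 * t := by rw [mul_one]; omega
  have hS2 : S ≡ r [MOD r ^ 2] := by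
    have := sum_one_add_pow_modEq hr2 1 t
    rwa [← hyt, mul_one] at this
  obtain ⟨S', hS'⟩ : r ∣ S := ((hS2.of_dvd (Dvd.intro_left r (by ring))).dvd_iff dvd_rfl).2 dvd_rfl
  have hrS' : ¬ r ∣ S' := by
    rintro ⟨S'', rfl⟩
    have h1 : r ^ 2 ∣ r := (hS2.dvd_iff dvd_rfl).1 ⟨S'', by rw [hS']; ring⟩
    have h2 := Nat.le_of_dvd hr.pos h1
    nlinarith [hr.two_le]
  -- `S` contains exactly one factor `r` and nothing else in common with `N`; hence `N` divides `(y
  -- - 1) * r`.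
  have hcop : N.Coprime S' := by
    refine Nat.Coprime.symm (Nat.coprime_of_dvd fun q hqp hqS hqN => ?_)
    have h1 : q ∣ r := ((hSq q hqp hqN).dvd_iff dvd_rfl).1 (hS' ▸ hqS.mul_left r)
    have h2 := (Nat.prime_dvd_prime_iff_eq hqp hr).1 h1
    exact hrS' (h2 ▸ hqS)
  have hdvd2 : N ∣ (y - 1) * r := by
    refine hcop.dvd_of_dvd_mul_right ?_
    rw [mul_assoc, ← hS']
    exact hdvd
  obtain ⟨m, rfl⟩ := hrN
  obtain ⟨b, hb⟩ : m ∣ y - 1 := by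
    rw [mul_comm] at hdvd2
    exact Nat.dvd_of_mul_dvd_mul_right hr.pos hdvd2
  have hrb : ¬ r ∣ b := by
    rintro ⟨b', rfl⟩
    exact hny ⟨b', by rw [hb]; ring⟩
  obtain ⟨n, rfl⟩ : r ∣ m := by
    have : r ∣ m * b := by rw [← hb]; exact ⟨t, ht⟩
    exact (hr.dvd_mul.1 this).resolve_right hrb
  exact ⟨n, b, by ring, by omega, hrb⟩

/-- A suitable power of `ℓ` has order `r` modulo `p = 2 * r + 1` and `r`-power order modulo `N`. -/
theorem exists_pow_order {ℓ p r N : ℕ} (hp : p.Prime) (hpr : p = 2 * r + 1) (hr : r.Prime)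
    (hr2 : Odd r) (hN : 0 < N) (hℓN : ℓ.Coprime N) (hℓp : ℓ.Coprime p)
    (hℓ2 : ¬ ℓ ^ 2 ≡ 1 [MOD p])
    (hq : ∀ q : ℕ, q.Prime → q ∣ N → ¬ r ∣ orderOf (ℓ : ZMod q)) :
    ∃ k : ℕ, (ℓ ^ k) ^ r ≡ 1 [MOD p] ∧ (∀ a, 0 < a → a < r → ¬ (ℓ ^ k) ^ a ≡ 1 [MOD p]) ∧
      (∀ q : ℕ, q.Prime → q ∣ N → ℓ ^ k ≡ 1 [MOD q]) ∧
      ∃ v : ℕ, (ℓ ^ k) ^ (r ^ v) ≡ 1 [MOD N] := by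
  have := NeZero.of_pos hN
  have hcast : ∀ (n e : ℕ), ℓ ^ e ≡ 1 [MOD n] ↔ (ℓ : ZMod n) ^ e = 1 := fun n e => by
    rw [← ZMod.natCast_eq_natCast_iff]
    push_cast
    rfl
  have hordN : 0 < orderOf (ℓ : ZMod N) := by
    rw [orderOf_pos_iff, isOfFinOrder_iff_pow_eq_one]
    refine ⟨N.totient, Nat.totient_pos.2 hN, (hcast _ _).1 (Nat.ModEq.pow_totient hℓN)⟩
  obtain ⟨a, m, hm, ham⟩ := Nat.exists_eq_pow_mul_and_not_dvd hordN.ne' r hr.ne_one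
  -- `m` is the prime-to-`r` part of the order of `ℓ` modulo `N`; the factor 2 removes the even part
  -- of the group of order `p - 1 = 2 * r`.
  refine ⟨2 * m, ?_, ?_, ?_, a, ?_⟩
  · have h1 := Nat.ModEq.pow_totient hℓp
    rw [Nat.totient_prime hp, show p - 1 = 2 * r by omega] at h1
    rw [← pow_mul, show 2 * m * r = 2 * r * m by ring, pow_mul]
    simpa using h1.pow m
  · intro b hb hbr hmod
    rw [← pow_mul, hcast] at hmod
    have h1 := Nat.ModEq.pow_totient hℓp
    rw [Nat.totient_prime hp, show p - 1 = 2 * r by omega, hcast] at h1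
    have h2 := orderOf_dvd_of_pow_eq_one hmod
    have h3 := orderOf_dvd_of_pow_eq_one h1
    have hcop : (orderOf (ℓ : ZMod p)).Coprime r := by
      refine ((Nat.Prime.coprime_iff_not_dvd hr).2 fun h => ?_).symm
      rcases hr.dvd_mul.1 (h.trans h2) with h4 | h4
      · rcases hr.dvd_mul.1 h4 with h5 | h5
        · have := (Nat.prime_dvd_prime_iff_eq hr Nat.prime_two).1 h5
          rw [this] at hr2
          exact absurd hr2 (by decide)
        · exact hm h5
      · exact Nat.not_dvd_of_pos_of_lt hb hbr h4
    exact hℓ2 ((hcast _ _).2 (orderOf_dvd_iff_pow_eq_one.1 (hcop.dvd_of_dvd_mul_right h3)))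
  · intro q hqp hqN
    have h1 : (ℓ : ZMod q) ^ (r ^ a * m) = 1 := by
      rw [← hcast]
      refine Nat.ModEq.of_dvd hqN ?_
      rw [hcast, ← ham]
      exact pow_orderOf_eq_one _
    have h2 : (orderOf (ℓ : ZMod q)).Coprime (r ^ a) :=
      Nat.Coprime.pow_right a ((Nat.Prime.coprime_iff_not_dvd hr).2 (hq q hqp hqN)).symm
    have h3 := h2.dvd_of_dvd_mul_left (orderOf_dvd_of_pow_eq_one h1)
    rw [hcast]
    exact orderOf_dvd_iff_pow_eq_one.1 (h3.mul_left 2)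
  · rw [← pow_mul, hcast, mul_comm, mul_left_comm, ← ham, mul_comm, pow_mul, pow_orderOf_eq_one,
      one_pow]

/-- `α` equals a root of unity times one of the explicit numbers `(A + √-p) / 2`, respectively
`(1 + i) * (A + √-p) / 2`, that occur in the table. -/
def HasTableForm {K : Type*} [Field K] (n : ℕ) (α : K) : Prop :=
  ∃ A B δ : K, 2 * α = B * (A + δ) ∧
    ((A ^ 2 = 5 ∧ δ ^ 2 = -11 ∧ B ^ n = 1) ∨ (A ^ 2 = 9 ∧ δ ^ 2 = -11 ∧ B ^ n = 1) ∨
      (A ^ 2 = 13 ∧ δ ^ 2 = -7 ∧ B ^ n = 1) ∨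
      (A ^ 2 = 3 ∧ δ ^ 2 = -7 ∧ ∃ u : K, u ^ n = 1 ∧ B ^ 2 = 2 * u))

theorem pow_eq_pow_of_modEq_of_modEq {K : Type*} [Field K] {M : ℕ} {ζ : K}
    (hζ : IsPrimitiveRoot ζ M) {p N a b : ℕ} (hM : M = p * N)
    (hcop : p.Coprime N) (hp : a ≡ b [MOD p]) (hN : a ≡ b [MOD N]) : ζ ^ a = ζ ^ b := by
  refine pow_eq_pow_of_modEq (n := M) ?_ hζ.pow_eq_one
  rw [hM]
  exact (Nat.modEq_and_modEq_iff_modEq_mul hcop).1 ⟨hp, hN⟩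

/-! ### The dichotomy at a fixed level -/

section Level

variable {K : Type*} [Field K] [NumberField K] {M : ℕ} [NeZero M] [IsCyclotomicExtension {M} ℚ K]
  {ζ : K}

theorem intDvd_of_modEq_one (hζ : IsPrimitiveRoot ζ M) {N x : ℕ}
    (hx : 0 < x) (hxN : x ≡ 1 [MOD N]) {σ : K ≃ₐ[ℚ] K} (hσ : σ ζ = ζ ^ x) {z : K}
    (hz : IsIntegral ℤ z) : IntDvd (1 - ζ ^ N) (σ z - z) := by
  refine intDvd_aut_sub hζ σ ?_ hz
  have hζi : IsIntegral ℤ ζ := hζ.isIntegral (NeZero.pos M)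
  obtain ⟨t, ht⟩ := (Nat.modEq_iff_dvd' hx).1 hxN.symm
  obtain rfl : x = 1 + N * t := by omega
  have : σ ζ - ζ = ζ * -(1 - (ζ ^ N) ^ t) := by rw [hσ]; ring
  rw [this]
  exact (IntDvd.one_sub_pow (hζi.pow N) t).neg.mul_left hζi

theorem exists_modEq_pow {p r x b : ℕ} (hp : p.Prime) (hr : r.Prime) (hxr : x ^ r ≡ 1 [MOD p])
    (hord : ∀ a, 0 < a → a < r → ¬ x ^ a ≡ 1 [MOD p]) (hb : b ^ r ≡ 1 [MOD p]) :
    ∃ i : ℕ, x ^ i ≡ b [MOD p] := by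
  have := Fact.mk hp
  have hcast : ∀ (y z : ℕ), y ≡ z [MOD p] ↔ (y : ZMod p) = (z : ZMod p) := fun y z =>
    (ZMod.natCast_eq_natCast_iff _ _ _).symm
  have hx : IsPrimitiveRoot (x : ZMod p) r := by
    refine IsPrimitiveRoot.mk_of_lt _ hr.pos ?_ fun a ha har h => hord a ha har ?_
    · have := (hcast _ _).1 hxr
      push_cast at this
      exact this
    · rw [hcast]
      push_cast
      exact h
  have hb' : (b : ZMod p) ^ r = 1 := by
    have := (hcast _ _).1 hb
    push_cast at this
    exact this
  have := NeZero.mk hr.ne_zero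
  obtain ⟨i, -, hi⟩ := hx.eq_pow_of_pow_eq_one hb'
  refine ⟨i, (hcast _ _).2 ?_⟩
  push_cast
  exact hi

/-- Invariance under the automorphisms of order `r` and `2` generating the inertia group at `p`
forces an element to lie in the field of `N`-th roots of unity. -/
theorem mem_adjoin_of_inertia_fixed (hζ : IsPrimitiveRoot ζ M) {p r N x z : ℕ} (hp : p.Prime)
    (hpr : p = 2 * r + 1) (hr : r.Prime) (hr2 : Odd r) (hM : M = p * N) (hcop : p.Coprime N)
    (hxN : x ≡ 1 [MOD N]) (hxr : x ^ r ≡ 1 [MOD p])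
    (hord : ∀ a, 0 < a → a < r → ¬ x ^ a ≡ 1 [MOD p]) (hzN : z ≡ 1 [MOD N])
    (hzp : z ≡ p - 1 [MOD p]) {s κ : K ≃ₐ[ℚ] K} (hs : s ζ = ζ ^ x) (hκ : κ ζ = ζ ^ z) {α : K}
    (hsα : s α = α) (hκα : κ α = α) :
    α ∈ IntermediateField.adjoin ℚ ({ζ ^ p} : Set K) := by
  have : IsGalois ℚ K := IsCyclotomicExtension.isGalois {M} ℚ K
  refine mem_adjoin_of_fixed fun τ hτ => ?_
  have hsi : ∀ i : ℕ, (s ^ i) α = α := by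
    intro i
    induction i with
    | zero => simp
    | succ i ih => rw [pow_succ, AlgEquiv.mul_apply, hsα, ih]
  obtain ⟨b, hbM, hb⟩ := exists_aut_eq_pow hζ τ
  have hN0 : N ≠ 0 := by rintro rfl; exact NeZero.ne M (by simpa using hM)
  have hζN : IsPrimitiveRoot (ζ ^ p) N := hζ.pow (NeZero.pos M) hM
  have hbN : b ≡ 1 [MOD N] := by
    rw [map_pow, hb, pow_right_comm] at hτ
    have h1 : (ζ ^ p) ^ ((b : ℤ) - ((1 : ℕ) : ℤ)) = 1 := by
      have h0 : ζ ^ p ≠ 0 := hζN.ne_zero hN0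
      rw [zpow_sub₀ h0, zpow_natCast, zpow_natCast, hτ, pow_one, div_self h0]
    exact (Int.natCast_modEq_iff.1 ((Int.modEq_iff_dvd).2
      ((hζN.zpow_eq_one_iff_dvd _).1 h1))).symm
  have hbp : b.Coprime p := Nat.Coprime.coprime_dvd_right ⟨N, hM⟩ hbM
  have hpow : ∀ (y : ℕ), y ^ r ≡ 1 [MOD p] → y ≡ 1 [MOD N] → ∃ i : ℕ, ζ ^ y = ζ ^ (x ^ i) := by
    intro y hy hyN
    obtain ⟨i, hi⟩ := exists_modEq_pow hp hr hxr hord hy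
    refine ⟨i, (pow_eq_pow_of_modEq_of_modEq hζ hM hcop hi ?_).symm⟩
    refine Nat.ModEq.trans ?_ hyN.symm
    simpa using hxN.pow i
  have hFermat : b ^ (2 * r) ≡ 1 [MOD p] := by
    have := Nat.ModEq.pow_totient hbp
    rwa [Nat.totient_prime hp, show p - 1 = 2 * r by omega] at this
  have := Fact.mk hp
  have hsq : ((b : ZMod p) ^ r) ^ 2 = 1 ^ 2 := by
    have := (ZMod.natCast_eq_natCast_iff _ _ _).2 hFermat
    push_cast at this
    rw [← pow_mul, mul_comm, this, one_pow]
  -- `b ^ r = ±1` modulo `p`. For `+1`, `τ` is a power of `s`; for `-1`, `κ * τ` is, since `r` is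
  -- odd.
  rcases eq_or_eq_neg_of_sq_eq_sq _ _ hsq with h | h
  · obtain ⟨i, hi⟩ := hpow b ((ZMod.natCast_eq_natCast_iff _ _ _).1 (by push_cast; exact h)) hbN
    have : τ = s ^ i := aut_ext hζ (by rw [hb, hi, aut_pow_apply hs])
    rw [this, hsi]
  · have hz : (z : ZMod p) = -1 := by
      have := (ZMod.natCast_eq_natCast_iff _ _ _).2 hzp
      rw [this, Nat.cast_sub hp.one_le]
      simp
    obtain ⟨i, hi⟩ := hpow (z * b) ((ZMod.natCast_eq_natCast_iff _ _ _).1 (by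
      push_cast
      rw [mul_pow, h, hz, hr2.neg_one_pow]
      norm_num)) (by simpa using hzN.mul hbN)
    have : κ * τ = s ^ i := aut_ext hζ (by
      rw [AlgEquiv.mul_apply, hb, map_pow, hκ, ← pow_mul, hi, aut_pow_apply hs])
    have h1 : κ (τ α) = α := by
      rw [← AlgEquiv.mul_apply, this, hsi]
    have h2 : κ (τ α) = κ α := by rw [h1, hκα]
    exact κ.injective h2

/-- The case where the chosen power of Frobenius is inertia at `p`. The integer `β` measuring `α - κ
α` either vanishes, giving descent to level `N`, or is so small that only finitely many normal forms
remain. -/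
theorem mem_adjoin_or_hasTableForm (hζ : IsPrimitiveRoot ζ M) {c : K ≃ₐ[ℚ] K} (hc : c ζ = ζ⁻¹)
    {p r N x C : ℕ} (hp : p.Prime) (hpr : p = 2 * r + 1) (hr : r.Prime) (hr2 : Odd r)
    (hM : M = p * N) (hcop : p.Coprime N) (hx : 0 < x) (hxN : x ≡ 1 [MOD N])
    (hxr : x ^ r ≡ 1 [MOD p]) (hord : ∀ a, 0 < a → a < r → ¬ x ^ a ≡ 1 [MOD p])
    (hC : (C = 4 ∧ 11 ≤ p) ∨ (C = 5 ∧ 7 ≤ p ∧ Nat.Coprime 5 M)) {s : K ≃ₐ[ℚ] K}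
    (hsζ : s ζ = ζ ^ x) {α v : K} (hα : IsIntegral ℤ α) (hαC : α * c α = C)
    (hv : v ^ (2 * N) = 1) (hsv : s α = v * α) :
    α ∈ IntermediateField.adjoin ℚ ({ζ ^ p} : Set K) ∨ HasTableForm (2 * M) α := by
  have hN0 : N ≠ 0 := by rintro rfl; exact NeZero.ne M (by simpa using hM)
  have hω : IsPrimitiveRoot (ζ ^ N) p := hζ.pow (NeZero.pos M) (by rw [hM, mul_comm])
  have hs : ∀ y : K, IsIntegral ℤ y → IntDvd (1 - ζ ^ N) (s y - y) := fun y hy =>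
    intDvd_of_modEq_one hζ hx hxN hsζ hy
  have hp7 : 7 ≤ p := by rcases hC with h | h <;> omega
  have hsα : s α = α := by
    refine eq_of_aut_ramified hp hω (n := 2 * N) (by omega) ?_ ?_ hs hα hαC hv hsv
    · rw [hp.dvd_mul, not_or]
      exact ⟨Nat.not_dvd_of_pos_of_lt two_pos (by omega),
        (Nat.Prime.coprime_iff_not_dvd hp).1 hcop⟩
    · rcases hC with ⟨rfl, h⟩ | ⟨rfl, h, -⟩
      · exact Nat.not_dvd_of_pos_of_lt (by norm_num) (by omega)
      · exact Nat.not_dvd_of_pos_of_lt (by norm_num) (by omega)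
  -- `z` is `-1` modulo `p` and 1 modulo `N`: the exponent of the inertia involution `κ`.
  obtain ⟨z, hzp, hzN⟩ := Nat.chineseRemainder hcop (p - 1) 1
  have hp1 : (p - 1).Coprime p := by
    have : (p - 1).Coprime (p - 1 + 1) := by simp
    rwa [Nat.sub_add_cancel hp.one_le] at this
  have hzM : z.Coprime M := by
    rw [hM]
    refine Nat.Coprime.mul_right ?_ ?_
    · rw [Nat.Coprime, hzp.gcd_eq]
      exact hp1
    · rw [Nat.Coprime, hzN.gcd_eq, Nat.gcd_one_left]
  have hz0 : 0 < z := by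
    rcases Nat.eq_zero_or_pos z with rfl | h
    · have := (Nat.coprime_zero_left M).1 hzM
      have h2 := Nat.le_of_dvd (NeZero.pos M) ⟨N, hM⟩
      omega
    · exact h
  obtain ⟨κ, hκζ⟩ := exists_aut hζ hzM
  have hκ : ∀ y : K, IsIntegral ℤ y → IntDvd (1 - ζ ^ N) (κ y - y) := fun y hy =>
    intDvd_of_modEq_one hζ hz0 hzN hκζ hy
  have hcω : c (ζ ^ N) = (ζ ^ N)⁻¹ := by rw [map_pow, hc, inv_pow]
  obtain ⟨⟨β, hβ, hββ, hφβ⟩, hX⟩ := exists_conj_sub_eq hζ hc hp hpr hr.pos hω hcω hs hκ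
    (h := x) (by rw [map_pow, hsζ, pow_right_comm]) hord hα hαC hsα
  by_cases hβ0 : β = 0
  · left
    rw [hβ0, mul_zero] at hββ
    have hκα : κ α = α := by
      rcases mul_eq_zero.1 hββ with h | h
      · exact (sub_eq_zero.1 h).symm
      · exact (sub_eq_zero.1 (c.injective (h.trans (map_zero c).symm))).symm
    exact mem_adjoin_of_inertia_fixed hζ hp hpr hr hr2 hM hcop hxN hxr hord hzN hzp hsζ hκζ hsα hκα
  right
  have hp4C : p ≤ 4 * C := by
    by_contra hlt
    refine hβ0 (eq_zero_of_norm_lt_one hβ fun φ => ?_)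
    obtain ⟨y, hy0, hy1, hy⟩ := hφβ φ
    rw [hy, Complex.norm_of_nonneg hy0]
    have h1 : (4 * C : ℝ) < p := by exact_mod_cast not_le.1 hlt
    by_contra hy2
    nlinarith [not_lt.1 hy2]
  have hnorm : ∀ {δ : K}, δ ^ 2 = -p → c δ = -δ → ∃ A B : K, IsIntegral ℤ B ∧ B * c B = β ∧
      2 * α = B * (A + δ) ∧ β * (A ^ 2 + p) = 4 * C := fun hδ hcδ =>
    exists_normal_form (fun y => aut_comm hζ c κ y) hp.ne_zero hδ hcδ hαC hββ hX hβ0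
  -- `p ≤ 4 * C ≤ 20`, and of the primes from 7 on only 7 and 11 have `(p - 1) / 2` prime.
  have hp_cases : p = 7 ∨ p = 11 := by
    have hr10 : r < 10 := by rcases hC with h | h <;> omega
    have hr3 : 3 ≤ r := by omega
    interval_cases r
    · exact Or.inl hpr
    · exact absurd hr (by norm_num)
    · exact Or.inr hpr
    · exact absurd hr (by norm_num)
    · exact absurd hp (by rw [hpr]; norm_num)
    · exact absurd hr (by norm_num)
    · exact absurd hr (by norm_num)
  rcases hp_cases with h7 | h11
  · obtain ⟨rfl, -, h5M⟩ : C = 5 ∧ 7 ≤ p ∧ Nat.Coprime 5 M := by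
      rcases hC with h | h
      · omega
      · exact h
    rw [h7] at hω
    obtain ⟨h, hhi, hh, hσh⟩ := exists_half_sqrt_neg_seven hω
    have hch : c h = -1 - h := by
      refine hσh c ?_
      rw [hcω]
      refine inv_eq_of_mul_eq_one_left ?_
      rw [← pow_succ, hω.pow_eq_one]
    have hδ2 : (2 * h + 1) ^ 2 = (-7 : K) := by linear_combination 4 * hh
    obtain ⟨A, B, hB, hBB, hαB, hA⟩ := hnorm (δ := 2 * h + 1) (by rw [hδ2, h7]; norm_num)
      (by rw [map_add, map_mul, map_ofNat, map_one, hch]; ring)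
    rw [h7] at hA
    push_cast at hA
    refine ⟨A, B, 2 * h + 1, hαB, ?_⟩
    rcases eq_one_or_eq_two_of_embeddings hβ hβ0 fun φ => by
      obtain ⟨y, hy0, hy1, hy⟩ := hφβ φ
      rw [h7] at hy1
      norm_num at hy1
      exact ⟨y, hy0, hy1, hy⟩ with hβ1 | hβ2 | hβg
    · rw [hβ1] at hA hBB
      exact Or.inr (Or.inr (Or.inl ⟨by linear_combination hA, hδ2,
        pow_eq_one_of_mul_conj_eq_one hζ hc hB hBB⟩))
    · rw [hβ2] at hA hBB
      have hA3 : A ^ 2 = 3 := by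
        have : (2 : K) ≠ 0 := two_ne_zero
        refine mul_left_cancel₀ this ?_
        linear_combination hA
      exact Or.inr (Or.inr (Or.inr ⟨hA3, hδ2,
        pow_eq_one_of_sq_three hζ hc hα hhi hB hA3 hBB hαB⟩))
    · exact absurd hβg (ne_golden hζ h5M hβ)
  · rw [h11] at hω
    obtain ⟨h, hhi, hh, hσh⟩ := exists_half_sqrt_neg_eleven hω
    have hch : c h = -1 - h := by
      refine hσh c ?_
      rw [hcω]
      refine inv_eq_of_mul_eq_one_left ?_
      rw [← pow_succ, hω.pow_eq_one]
    have hδ2 : (2 * h + 1) ^ 2 = (-11 : K) := by linear_combination 4 * hh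
    obtain ⟨A, B, hB, hBB, hαB, hA⟩ := hnorm (δ := 2 * h + 1) (by rw [hδ2, h11]; norm_num)
      (by rw [map_add, map_mul, map_ofNat, map_one, hch]; ring)
    -- `4 * C / 11 ≤ 20 / 11 < 2`.
    have hβ1 : β = 1 := eq_one_of_embeddings hβ hβ0 fun φ => by
      obtain ⟨y, hy0, hy1, hy⟩ := hφβ φ
      refine ⟨y, hy0, ?_, hy⟩
      have hC5 : (C : ℝ) ≤ 5 := by
        have : C ≤ 5 := by rcases hC with h | h <;> omega
        exact_mod_cast this
      rw [h11] at hy1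
      push_cast at hy1
      linarith
    rw [hβ1] at hA hBB
    rw [h11] at hA
    have hB1 := pow_eq_one_of_mul_conj_eq_one hζ hc hB hBB
    refine ⟨A, B, 2 * h + 1, hαB, ?_⟩
    rcases hC with ⟨rfl, -⟩ | ⟨rfl, -, -⟩
    · push_cast at hA
      exact Or.inl ⟨by linear_combination hA, hδ2, hB1⟩
    · push_cast at hA
      exact Or.inr (Or.inl ⟨by linear_combination hA, hδ2, hB1⟩)

/-- If an automorphism congruent to `1` modulo the radical of `N`, of order `r` modulo `N`,
multiplies `α` with a root of unity, then `α` comes from level `M / r`. -/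
theorem exists_mul_mem_adjoin_of_twisted (hζ : IsPrimitiveRoot ζ M) {c : K ≃ₐ[ℚ] K}
    (hc : c ζ = ζ⁻¹) {p r N x C : ℕ} (hp : p.Prime) (hpr : p = 2 * r + 1) (hr : r.Prime)
    (hr2 : Odd r) (hM : M = p * N) (hcop : p.Coprime N) (hx : 0 < x)
    (hxN : x ^ r ≡ 1 [MOD N]) (hxq : ∀ q : ℕ, q.Prime → q ∣ N → x ≡ 1 [MOD q])
    (hx1 : ¬ x ≡ 1 [MOD N]) (hxr : x ^ r ≡ 1 [MOD p])
    (hord : (∀ a, 0 < a → a < r → ¬ x ^ a ≡ 1 [MOD p]) ∨ x ≡ 1 [MOD p])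
    (hC0 : 0 < C) (hC : C ^ 2 < 4 * p) {σ : K ≃ₐ[ℚ] K}
    (hσ : σ ζ = ζ ^ x) {α v : K} (hα : IsIntegral ℤ α) (hαC : α * c α = C)
    (hv : v ^ (2 * N) = 1) (hσv : σ α = v * α) :
    ∃ n : ℕ, N = r ^ 2 * n ∧ ∃ w : K, w ^ (2 * M) = 1 ∧
      w * α ∈ IntermediateField.adjoin ℚ ({ζ ^ r} : Set K) := by
  have hN0 : N ≠ 0 := by rintro rfl; exact NeZero.ne M (by simpa using hM)
  have hα0 : α ≠ 0 := by
    rintro rfl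
    rw [zero_mul] at hαC
    exact hC0.ne' (by exact_mod_cast hαC.symm)
  have key : ∀ y : ℕ, 0 < y → y ≡ 1 [MOD p] → y ≡ x [MOD N] →
      ∃ n b : ℕ, N = r ^ 2 * n ∧ y = 1 + r * (p * n) * b ∧ ¬ r ∣ b := by
    intro y hy hyp hyN
    obtain ⟨n, b, hNn, hyb, hrb⟩ := exists_eq_one_add_mul hr hr2 (Nat.pos_of_ne_zero hN0) hy
      ((hyN.pow r).trans hxN) (fun q hqp hqN => (hyN.of_dvd hqN).trans (hxq q hqp hqN))
      fun h => hx1 (hyN.symm.trans h)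
    have hpb : p ∣ r * n * b := by
      have := (Nat.modEq_iff_dvd' hy).1 hyp.symm
      rwa [hyb, Nat.add_sub_cancel_left] at this
    have hpb' : p ∣ b := by
      refine Nat.Coprime.dvd_of_dvd_mul_left ?_ hpb
      exact Nat.Coprime.coprime_dvd_right ⟨r, by rw [hNn]; ring⟩ hcop
    obtain ⟨b', rfl⟩ := hpb'
    exact ⟨n, b', hNn, by rw [hyb]; ring, fun h => hrb (h.mul_left p)⟩
  have hdescend : ∀ (y : ℕ) (τ : K ≃ₐ[ℚ] K) (w u : K), 0 < y → y ≡ 1 [MOD p] → y ≡ x [MOD N] →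
      τ ζ = ζ ^ y → w ^ N = 1 → u ^ (2 * M) = 1 → τ (w * α) = u * (w * α) →
      ∃ n : ℕ, N = r ^ 2 * n ∧ ∃ w : K, w ^ (2 * M) = 1 ∧
        w * α ∈ IntermediateField.adjoin ℚ ({ζ ^ r} : Set K) := by
    intro y τ w u hy hyp hyN hτ hw hu hτα
    obtain ⟨n, b, hNn, hyb, hrb⟩ := key y hy hyp hyN
    have hw0 : w ≠ 0 := by
      rintro rfl
      rw [zero_pow hN0] at hw
      exact zero_ne_one hw
    obtain ⟨w', hw', hmem⟩ := exists_mul_mem_adjoin_pow hζ hr hr2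
      (n := p * n) (by rw [hM, hNn]; ring) hrb (by rw [hτ, hyb]) (mul_ne_zero hw0 hα0) hu hτα
    refine ⟨n, hNn, w' * w, ?_, by rwa [mul_assoc]⟩
    have hwM : w ^ M = 1 := by rw [hM, mul_comm, pow_mul, hw, one_pow]
    rw [mul_comm 2, pow_mul, mul_pow, hw', hwM, one_mul, one_pow]
  rcases hord with hord | hxp
  · have hxM : x.Coprime M := by
      refine Nat.Coprime.symm (Nat.coprime_of_dvd fun q hqp hqM hqx => ?_)
      have hq1 : ∀ {m}, q ∣ m → x ^ r ≡ 1 [MOD m] → False := fun hqm h => by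
        have h1 := (h.of_dvd hqm).dvd_iff dvd_rfl
        exact hqp.one_lt.ne' (Nat.dvd_one.1 (h1.1 (dvd_pow hqx hr.ne_zero)))
      rw [hM] at hqM
      rcases hqp.dvd_mul.1 hqM with h | h
      · exact hq1 h hxr
      · exact hq1 h hxN
    have hx_p : x.Coprime p := hxM.coprime_dvd_right ⟨N, hM⟩
    have hx_N : x.Coprime N := hxM.coprime_dvd_right ⟨p, by rw [hM, mul_comm]⟩
    -- Split `σ` as `s * τ`, with `τ` trivial on `p`-th and `s` on `N`-th roots of unity. Only `τ`
    -- generates the group needed for the descent, so the eigenvalue equation must be moved from `σ`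
    -- to `τ`.
    obtain ⟨y, hyp, hyN⟩ := Nat.chineseRemainder hcop 1 x
    obtain ⟨z, hzp, hzN⟩ := Nat.chineseRemainder hcop x 1
    have hyM : y.Coprime M := by
      rw [hM]
      refine Nat.Coprime.mul_right ?_ ?_
      · rw [Nat.Coprime, hyp.gcd_eq, Nat.gcd_one_left]
      · rw [Nat.Coprime, hyN.gcd_eq]
        exact hx_N
    have hzM : z.Coprime M := by
      rw [hM]
      refine Nat.Coprime.mul_right ?_ ?_
      · rw [Nat.Coprime, hzp.gcd_eq]
        exact hx_p
      · rw [Nat.Coprime, hzN.gcd_eq, Nat.gcd_one_left]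
    have hM1 : M ≠ 1 := by
      intro h
      rw [h] at hM
      exact hp.ne_one (Nat.eq_one_of_mul_eq_one_right hM.symm)
    have hpos : ∀ {t : ℕ}, t.Coprime M → 0 < t := fun {t} ht => by
      rcases Nat.eq_zero_or_pos t with rfl | h
      · exact absurd ((Nat.coprime_zero_left M).1 ht) hM1
      · exact h
    obtain ⟨τ, hτ⟩ := exists_aut hζ hyM
    obtain ⟨s, hs⟩ := exists_aut hζ hzM
    have hsτ : s * τ = σ := aut_ext hζ (by
      rw [AlgEquiv.mul_apply, hτ, map_pow, hs, ← pow_mul, hσ]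
      refine pow_eq_pow_of_modEq_of_modEq hζ hM hcop ?_ ?_
      · simpa using hzp.mul hyp
      · simpa using hzN.mul hyN)
    obtain ⟨n, b, hNn, hyb, hrb⟩ := key y (hpos hyM) hyp hyN
    obtain ⟨n', b', hNn', hxb, hrb'⟩ := exists_eq_one_add_mul hr hr2 (Nat.pos_of_ne_zero hN0) hx
      hxN hxq hx1
    have hσr : σ ^ r = 1 := aut_ext hζ (by
      rw [aut_pow_apply hσ, AlgEquiv.one_apply]
      conv_rhs => rw [← pow_one ζ]
      exact pow_eq_pow_of_modEq_of_modEq hζ hM hcop hxr hxN)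
    obtain ⟨w, hw, hwα⟩ := exists_mul_fixed hζ hr hr2 (k := p) hM ⟨r, hpr⟩ hNn' hrb'
      (by rw [map_pow, hσ, ← hxb, pow_right_comm]) hσr hα0 hv hσv
    have hwi : IsIntegral ℤ w := isIntegral_of_pow_eq_one (Nat.pos_of_ne_zero hN0) hw
    have hcw : w * c w = 1 := by
      have hwM : w ^ M = 1 := by rw [hM, mul_comm, pow_mul, hw, one_pow]
      obtain ⟨k, -, rfl⟩ := hζ.eq_pow_of_pow_eq_one hwM
      rw [map_pow, hc, ← mul_pow, mul_inv_cancel₀ (hζ.ne_zero (NeZero.ne M)), one_pow]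
    have hω : IsPrimitiveRoot (ζ ^ N) p := hζ.pow (NeZero.pos M) (by rw [hM, mul_comm])
    have hη : IsPrimitiveRoot (ζ ^ (r * (p * n) * b)) r := by
      have h1 : IsPrimitiveRoot (ζ ^ (r * (p * n))) r :=
        hζ.pow (NeZero.pos M) (by rw [hM, hNn]; ring)
      rw [pow_mul]
      exact h1.pow_of_coprime b (((Nat.Prime.coprime_iff_not_dvd hr).2 hrb).symm)
    have hrN : r ∣ N := ⟨r * n, by rw [hNn]; ring⟩
    set η := ζ ^ (r * (p * n) * b) with hηdef
    have hfixη : ∀ {t : ℕ} {ρ : K ≃ₐ[ℚ] K}, ρ ζ = ζ ^ t → t ≡ 1 [MOD r] → ρ η = η := by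
      intro t ρ hρ ht
      rw [aut_apply_of_pow_eq_one hζ hρ (by rw [hηdef, pow_right_comm, hζ.pow_eq_one, one_pow])]
      conv_rhs => rw [← pow_one η]
      exact pow_eq_pow_of_modEq ht hη.pow_eq_one
    obtain ⟨u, hu, huα⟩ := exists_eigenvalue_of_fixed hζ hc hp hpr hr hr2 hω hη
      (hrN.trans ⟨p, by rw [hM, mul_comm]⟩) (s := s) (τ := τ) (h := x) (C := C)
      (fun t ht => intDvd_of_modEq_one hζ (hpos hzM) hzN hs ht)
      (by
        rw [map_pow, hs, pow_right_comm]
        exact pow_eq_pow_of_modEq hzp hω.pow_eq_one) hord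
      (hfixη hs (hzN.of_dvd hrN))
      (hfixη hτ ((hyN.of_dvd hrN).trans (hxq r hr hrN)))
      (by rw [hτ, hηdef, ← pow_succ, hyb, add_comm 1]) (hwi.mul hα)
      (by rw [map_mul, mul_mul_mul_comm, hcw, one_mul, hαC]) hC
      (by rw [← AlgEquiv.mul_apply, hsτ, hwα])
    refine hdescend y τ w u (hpos hyM) hyp hyN hτ hw ?_ huα
    exact pow_two_mul_eq_one M hr.pos hu
  · refine hdescend x σ 1 v hx hxp rfl hσ (one_pow N) ?_ (by rwa [one_mul])
    rw [hM, mul_left_comm, mul_comm, pow_mul, hv, one_pow]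

/-- The dichotomy for integers `α` with `α * conj α ∈ {4, 5}`. -/
theorem descent_or_mem_adjoin_or_hasTableForm (hζ : IsPrimitiveRoot ζ M) {c : K ≃ₐ[ℚ] K}
    (hc : c ζ = ζ⁻¹) {ℓ p r N C : ℕ} (hp : p.Prime) (hpr : p = 2 * r + 1) (hr : r.Prime)
    (hr2 : Odd r) (hM : M = p * N) (hcop : p.Coprime N) (hℓM : ℓ.Coprime M)
    (hC : (ℓ = 2 ∧ C = 4 ∧ 11 ≤ p) ∨ (ℓ = 5 ∧ C = 5 ∧ 7 ≤ p))
    (hq : ∀ q : ℕ, q.Prime → q ∣ N → ¬ r ∣ orderOf (ℓ : ZMod q)) {α : K}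
    (hα : IsIntegral ℤ α) (hαC : α * c α = C) :
    (∃ n : ℕ, N = r ^ 2 * n ∧ ∃ w : K, w ^ (2 * M) = 1 ∧
      w * α ∈ IntermediateField.adjoin ℚ ({ζ ^ r} : Set K)) ∨
    ∃ w : K, w ^ (2 * M) = 1 ∧ (w * α ∈ IntermediateField.adjoin ℚ ({ζ ^ p} : Set K) ∨
      HasTableForm (2 * M) (w * α)) := by
  have hN0 : N ≠ 0 := by rintro rfl; exact NeZero.ne M (by simpa using hM)
  have hp7 : 7 ≤ p := by rcases hC with h | h <;> omega
  obtain ⟨σ, hσ⟩ := exists_aut hζ hℓM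
  have hd : IntDvd α (σ α) := by
    rcases hC with ⟨rfl, rfl, -⟩ | ⟨rfl, rfl, -⟩
    · exact intDvd_aut_of_mul_conj_eq_four hζ hℓM hσ hα (by simpa using hαC)
    · exact intDvd_aut_of_mul_conj_eq_self hζ Nat.prime_five hσ hα hαC
  have hC0 : C ≠ 0 := by rcases hC with h | h <;> omega
  have hℓ0 : 0 < ℓ := by rcases hC with h | h <;> omega
  obtain ⟨u, hu, huα⟩ := exists_root_aut_apply_eq hζ hc hC0 hαC hd
  obtain ⟨w, v, hw, hv, hwα⟩ := exists_mul_root_aut_apply_eq hζ hp.pos hM (by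
    have h2 : Nat.Coprime 2 p := (Nat.coprime_primes Nat.prime_two hp).2 (by omega)
    refine Nat.Coprime.mul_left (Nat.Coprime.mul_left h2 hcop.symm) ?_
    rcases hC with ⟨rfl, -⟩ | ⟨rfl, -⟩
    · exact Nat.coprime_one_left p
    · exact Nat.Coprime.pow_left 2 h2) hℓ0 hσ hu huα
  have h2M : 0 < 2 * M := Nat.mul_pos two_pos (NeZero.pos M)
  have hwi : IsIntegral ℤ w := isIntegral_of_pow_eq_one h2M hw
  have hcw : w * c w = 1 := by
    have hw2 : (w ^ 2) ^ M = 1 := by rw [← pow_mul, hw]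
    have hnorm : ∀ φ : K →+* ℂ, ‖φ w‖ = 1 := fun φ =>
      Complex.norm_eq_one_of_pow_eq_one (n := 2 * M) (by rw [← map_pow, hw, map_one]) h2M.ne'
    let φ : K →+* ℂ := (IsAlgClosed.lift (R := ℚ) (S := K) (M := ℂ)).toRingHom
    refine φ.injective ?_
    rw [embedding_mul_conj hζ hc, hnorm]
    simp
  have hβC : w * α * c (w * α) = C := by rw [map_mul, mul_mul_mul_comm, hcw, one_mul, hαC]
  have hβ := hwi.mul hα
  -- `ℓ ^ 2 - 1` is 3 or 24, with no prime factor above 3.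
  have hℓ2 : ¬ ℓ ^ 2 ≡ 1 [MOD p] := by
    intro h
    have h1 := (Nat.modEq_iff_dvd' (Nat.one_le_pow _ _ hℓ0)).1 h.symm
    rcases hC with ⟨rfl, -⟩ | ⟨rfl, -⟩
    · have := Nat.le_of_dvd (by norm_num) h1
      omega
    · have h24 : p ∣ 2 ^ 3 * 3 := h1
      rcases hp.dvd_mul.1 h24 with h3 | h3
      · have := Nat.le_of_dvd (by norm_num) (hp.dvd_of_dvd_pow h3)
        omega
      · have := Nat.le_of_dvd (by norm_num) h3
        omega
  obtain ⟨k, hkr, hkord, hkq, hkv⟩ := exists_pow_order hp hpr hr hr2 (Nat.pos_of_ne_zero hN0)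
    (hℓM.coprime_dvd_right ⟨p, by rw [hM, mul_comm]⟩) (hℓM.coprime_dvd_right ⟨N, hM⟩) hℓ2 hq
  set x := ℓ ^ k with hx
  have hx0 : 0 < x := Nat.pow_pos hℓ0
  classical
  -- By minimality, `x ^ (r ^ (m - 1))` has order exactly `r` modulo `N` when `m > 0`.
  let m := Nat.find hkv
  have hm : x ^ r ^ m ≡ 1 [MOD N] := Nat.find_spec hkv
  rcases Nat.eq_zero_or_pos m with hm0 | hmpos
  · right
    refine ⟨w, hw, ?_⟩
    obtain ⟨v', hv', hα'⟩ := exists_aut_pow_apply_eq hwα hv k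
    rw [hm0, pow_zero, pow_one] at hm
    exact mem_adjoin_or_hasTableForm hζ hc hp hpr hr hr2 hM hcop hx0 hm hkr hkord
      (by
        rcases hC with ⟨h1, h2, h3⟩ | ⟨rfl, h2, h3⟩
        · exact Or.inl ⟨h2, h3⟩
        · exact Or.inr ⟨h2, h3, hℓM⟩) (aut_pow_apply hσ k) hβ hβC hv' hα'
  · left
    obtain ⟨j, hj⟩ := Nat.exists_eq_add_of_lt hmpos
    have hmin : ¬ x ^ r ^ j ≡ 1 [MOD N] := Nat.find_min hkv (by omega)
    rw [hj, zero_add, pow_succ, pow_mul] at hm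
    have hone : ∀ {n : ℕ} (e : ℕ), x ≡ 1 [MOD n] → x ^ e ≡ 1 [MOD n] := fun e h => by
      simpa using h.pow e
    obtain ⟨v', hv', hα'⟩ := exists_aut_pow_apply_eq hwα hv (k * r ^ j)
    obtain ⟨n, hn, w', hw', hmem⟩ := exists_mul_mem_adjoin_of_twisted hζ hc hp hpr hr hr2 hM hcop
      (x := x ^ r ^ j) (Nat.pow_pos hx0) hm (fun q hqp hqN => hone _ (hkq q hqp hqN)) hmin
      (by
        rw [pow_right_comm]
        simpa using hkr.pow (r ^ j))
      (by
        -- For `j = 0` the exponent still has order `r` modulo `p`; for `j > 0` it is already 1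
        -- there, as `x ^ r ≡ 1`.
        rcases Nat.eq_zero_or_pos j with rfl | hj0
        · left
          simpa using hkord
        · right
          obtain ⟨i, rfl⟩ := Nat.exists_eq_add_of_lt hj0
          rw [zero_add, pow_succ', pow_mul]
          simpa using hkr.pow (r ^ i))
      (Nat.pos_of_ne_zero hC0) (by rcases hC with ⟨-, rfl, h⟩ | ⟨-, rfl, h⟩ <;> omega)
      (by rw [aut_pow_apply hσ, pow_mul]) hβ hβC hv' hα'
    exact ⟨n, hn, w' * w, by rw [mul_pow, hw', hw, one_mul], by rwa [mul_assoc]⟩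

end Level

/-! ### Cyclotomic subfields of `ℂ` and induction on the level -/

instance isCyclotomicExtension_cycloField (n : ℕ) [NeZero n] :
    IsCyclotomicExtension {n} ℚ (cycloField n) := by
  have hζ := isPrimitiveRoot_zeta (NeZero.ne n)
  have halg : IsAlgebraic ℚ (zeta n) :=
    ((hζ.isIntegral (NeZero.pos n)).tower_top (A := ℚ)).isAlgebraic
  change IsCyclotomicExtension {n} ℚ (IntermediateField.adjoin ℚ {zeta n}).toSubalgebra
  rw [IntermediateField.adjoin_simple_toSubalgebra_of_isAlgebraic halg]
  exact hζ.adjoin_isCyclotomicExtension ℚ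

instance numberField_cycloField (n : ℕ) [NeZero n] : NumberField (cycloField n) :=
  IsCyclotomicExtension.numberField {n} ℚ (cycloField n)

theorem zeta_mem_cycloField (n : ℕ) : zeta n ∈ cycloField n :=
  IntermediateField.mem_adjoin_simple_self ℚ (zeta n)

theorem zeta_mul_pow {m n : ℕ} (hm : m ≠ 0) : zeta (m * n) ^ m = zeta n := by
  rw [zeta, zeta, ← Complex.exp_nat_mul]
  congr 1
  have : (m : ℂ) ≠ 0 := by exact_mod_cast hm
  push_cast
  rw [mul_div_assoc', mul_div_mul_left _ _ this]

theorem cycloField_le_mul {m n : ℕ} (hm : m ≠ 0) : cycloField n ≤ cycloField (m * n) := by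
  rw [cycloField, IntermediateField.adjoin_simple_le_iff, ← zeta_mul_pow (n := n) hm]
  exact pow_mem (zeta_mem_cycloField _) m

theorem Reducible.mono {N m : ℕ} (hm : m ≠ 0) {α : ℂ} (h : Reducible N α) :
    Reducible (m * N) α := by
  obtain ⟨u, hu, h⟩ := h
  exact ⟨u, hu, h.imp_left fun h => cycloField_le_mul hm h⟩

/-- The generator of `cycloField n` as an element of that field. -/
noncomputable def zetaGen (n : ℕ) : cycloField n := ⟨zeta n, zeta_mem_cycloField n⟩

theorem isPrimitiveRoot_zetaGen {n : ℕ} (hn : n ≠ 0) : IsPrimitiveRoot (zetaGen n) n :=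
  IsPrimitiveRoot.coe_submonoidClass_iff.1 (isPrimitiveRoot_zeta hn)

theorem coe_mem_cycloField_of_mem_adjoin {m n : ℕ} (hm : m ≠ 0) {x : cycloField (m * n)}
    (hx : x ∈ IntermediateField.adjoin ℚ ({zetaGen (m * n) ^ m} : Set (cycloField (m * n)))) :
    (x : ℂ) ∈ cycloField n := by
  have h1 : (x : ℂ) ∈ IntermediateField.map (cycloField (m * n)).val
      (IntermediateField.adjoin ℚ ({zetaGen (m * n) ^ m} : Set (cycloField (m * n)))) :=
    ⟨x, hx, rfl⟩
  rw [IntermediateField.adjoin_map, Set.image_singleton, map_pow] at h1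
  have h2 : (cycloField (m * n)).val (zetaGen (m * n)) ^ m = zeta n := zeta_mul_pow hm
  rwa [h2] at h1

theorem isRootOfOne_coe {n k : ℕ} (hk : 0 < k) {u : cycloField n} (hu : u ^ k = 1) :
    IsRootOfOne (u : ℂ) := ⟨k, hk, by rw [← IntermediateField.coe_pow, hu]; rfl⟩

theorem coe_mul_conj {n : ℕ} [NeZero n] {c : cycloField n ≃ₐ[ℚ] cycloField n}
    (hc : c (zetaGen n) = (zetaGen n)⁻¹) (x : cycloField n) :
    ((x * c x : cycloField n) : ℂ) = x * (starRingEnd ℂ) x := by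
  have := embedding_conj (isPrimitiveRoot_zetaGen (NeZero.ne n)) hc
    (algebraMap (cycloField n) ℂ) x
  rw [IntermediateField.coe_mul]
  congr 1

/-- The house is attained at some embedding `φ`, where `φ (a * c a) = C`. Injectivity of `φ` turns
this into an identity in the field, valid at every embedding. -/
theorem mul_conj_eq_of_house {n C : ℕ} (hn : n ≠ 0) {α : ℂ} (hα : IsIntegral ℤ α)
    (hmem : α ∈ cycloField n) (h : house α ^ 2 = C) : α * (starRingEnd ℂ) α = C := by
  have := NeZero.mk hn
  obtain ⟨β, hβ, hβα⟩ := (isGreatest_house (hα.tower_top (A := ℚ))).1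
  have hζ := isPrimitiveRoot_zetaGen hn
  obtain ⟨c, hc⟩ := exists_conj hζ
  set a : cycloField n := ⟨α, hmem⟩ with ha
  have hmin : minpoly ℚ a = minpoly ℚ α :=
    (minpoly.algebraMap_eq (B' := ℂ) (algebraMap (cycloField n) ℂ).injective a).symm
  obtain ⟨φ, hφ⟩ : ∃ φ : cycloField n →ₐ[ℚ] ℂ, φ a = β := by
    have : β ∈ (minpoly ℚ a).rootSet ℂ := by
      rw [hmin, Polynomial.mem_rootSet]
      exact ⟨minpoly.ne_zero (hα.tower_top (A := ℚ)), hβ.aeval_eq_zero⟩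
    rw [← Algebra.IsAlgebraic.range_eval_eq_rootSet_minpoly ℂ a] at this
    exact this
  have h1 := embedding_mul_conj hζ hc (φ : cycloField n →+* ℂ) a
  have h2 : (φ : cycloField n →+* ℂ) a = β := hφ
  rw [h2, ← hβα, h] at h1
  have h3 : a * c a = C := by
    refine (φ : cycloField n →+* ℂ).injective ?_
    rw [h1, map_natCast]
    simp
  rw [← coe_mul_conj hc a, h3]
  rfl

theorem HasTableForm.reducible {n k N : ℕ} (hk : 0 < k) {α : cycloField n}
    (h : HasTableForm k α) : Reducible N (α : ℂ) := by
  obtain ⟨A, B, δ, hα, h⟩ := h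
  have hcast : ∀ {x y : cycloField n}, x = y → (x : ℂ) = y := fun h => congrArg _ h
  have hα' : 2 * (α : ℂ) = B * (A + δ) := hcast hα
  rcases h with ⟨hA, hδ, hB⟩ | ⟨hA, hδ, hB⟩ | ⟨hA, hδ, hB⟩ | ⟨hA, hδ, u, hu, hB⟩
  · exact reducible_of_sq_five_eleven (isRootOfOne_coe hk hB) (hcast hA) (hcast hδ) hα'
  · exact reducible_of_sq_nine_eleven (isRootOfOne_coe hk hB) (hcast hA) (hcast hδ) hα'
  · exact reducible_of_sq_thirteen_seven (isRootOfOne_coe hk hB) (hcast hA) (hcast hδ) hα'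
  · exact reducible_of_sq_three_seven (isRootOfOne_coe hk hu) (hcast hB) (hcast hA) (hcast hδ) hα'

/-- Strong induction on `N`: in the descent case `N = r ^ 2 * n` is replaced by `r * n`, whose prime
factors still satisfy the order hypothesis. -/
theorem reducible_of_mul_conj {ℓ p r C : ℕ} (hp : p.Prime) (hpr : p = 2 * r + 1) (hr : r.Prime)
    (hr2 : Odd r) (hC : (ℓ = 2 ∧ C = 4 ∧ 11 ≤ p) ∨ (ℓ = 5 ∧ C = 5 ∧ 7 ≤ p)) (N : ℕ)
    (hN : 0 < N) (hcop : N.Coprime (ℓ * p))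
    (hq : ∀ q : ℕ, q.Prime → q ∣ N → ¬ r ∣ orderOf (ℓ : ZMod q)) {α : ℂ} (hα : IsIntegral ℤ α)
    (hmem : α ∈ cycloField (p * N)) (hαC : α * (starRingEnd ℂ) α = C) : Reducible N α := by
  induction N using Nat.strong_induction_on generalizing α with
  | _ N ih =>
  have := NeZero.mk (Nat.mul_pos hp.pos hN).ne'
  have hζ := isPrimitiveRoot_zetaGen (NeZero.ne (p * N))
  obtain ⟨c, hc⟩ := exists_conj hζ
  set a : cycloField (p * N) := ⟨α, hmem⟩ with ha
  have hai : IsIntegral ℤ a :=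
    (isIntegral_algebraMap_iff (algebraMap (cycloField (p * N)) ℂ).injective).1 hα
  have haC : a * c a = C := by
    refine Subtype.ext ?_
    rw [coe_mul_conj hc a, hαC]
    rfl
  have hℓp : ℓ.Coprime p := by
    rcases hC with ⟨rfl, -, h⟩ | ⟨rfl, -, h⟩
    · exact (Nat.coprime_primes Nat.prime_two hp).2 (by omega)
    · exact (Nat.coprime_primes Nat.prime_five hp).2 (by omega)
  have hℓN : ℓ.Coprime N := hcop.symm.coprime_dvd_left ⟨p, rfl⟩
  have hpN : p.Coprime N := hcop.symm.coprime_dvd_left ⟨ℓ, mul_comm ℓ p⟩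
  have h2M : 0 < 2 * (p * N) := Nat.mul_pos two_pos (Nat.mul_pos hp.pos hN)
  rcases descent_or_mem_adjoin_or_hasTableForm hζ hc hp hpr hr hr2 rfl hpN
    (Nat.Coprime.mul_right hℓp hℓN) hC hq hai haC with
    ⟨n, hn, w, hw, hmem'⟩ | ⟨w, hw, hmem' | htable⟩
  · have hw' := isRootOfOne_coe h2M hw
    have hn0 : 0 < n := Nat.pos_of_ne_zero (by rintro rfl; simp [hn] at hN)
    have hNr : N = r * (r * n) := by rw [hn]; ring
    have hwα : Reducible (r * n) ((w : ℂ) * α) := by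
      refine ih (r * n) ?_ (Nat.mul_pos hr.pos hn0) ?_ ?_ ?_ ?_ ?_
      · rw [hNr]
        exact lt_mul_of_one_lt_left (Nat.mul_pos hr.pos hn0) hr.one_lt
      · exact hcop.coprime_dvd_left ⟨r, by rw [hNr, mul_comm]⟩
      · exact fun q hqp hqn => hq q hqp (hqn.trans ⟨r, by rw [hNr, mul_comm]⟩)
      · refine IsIntegral.mul ?_ hα
        obtain ⟨k, hk, hwk⟩ := hw'
        exact isIntegral_of_pow_eq_one hk hwk
      · have hM : p * N = r * (p * (r * n)) := by rw [hNr]; ring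
        clear_value a
        -- The level occurs in the type of `a` and `w`, so it is made a variable before being
        -- replaced by `r * (p * (r * n))`.
        generalize p * N = M at *
        subst hM
        have := coe_mem_cycloField_of_mem_adjoin hr.ne_zero hmem'
        rw [IntermediateField.coe_mul, ha] at this
        exact this
      · rw [map_mul, hw'.conj_eq_inv, mul_mul_mul_comm, mul_inv_cancel₀ hw'.ne_zero, one_mul, hαC]
    rw [hNr]
    exact (Reducible.of_mul hw' hwα).mono hr.ne_zero
  · have hw' := isRootOfOne_coe h2M hw
    exact ⟨w, hw', Or.inl (coe_mem_cycloField_of_mem_adjoin hp.ne_zero hmem')⟩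
  · exact Reducible.of_mul (isRootOfOne_coe h2M hw) (htable.reducible h2M)

end CyclotomicCastle

/-! ### The main statement -/

theorem lemma6p8 (ℓ c p₀ : ℕ)
    (hℓ : (ℓ, c, p₀) ∈ ({(2, 4, 11), (5, 5, 7)} : Set (ℕ × ℕ × ℕ)))
    (p : ℕ) (hp : p.Prime) (hp₀ : p₀ ≤ p) (hr : ((p - 1) / 2).Prime) :
    p ≡ 3 [MOD 4] ∧
    ∀ N : ℕ, 0 < N → N.Coprime (ℓ * p) →
      (∀ q : ℕ, q.Prime → q ∣ N → ¬ (p - 1) / 2 ∣ q - 1 →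
        ¬ (p - 1) / 2 ∣ orderOf (ℓ : ZMod q)) ∧
      ((∀ q : ℕ, q.Prime → q ∣ N → ¬ (p - 1) / 2 ∣ orderOf (ℓ : ZMod q)) →
        ∀ α : ℂ, IsIntegral ℤ α → α ∈ CyclotomicCastle.cycloField (p * N) →
          CyclotomicCastle.house α ^ 2 = (c : ℝ) →
          CyclotomicCastle.Covered α ∨
            ∃ β ∈ CyclotomicCastle.cycloField N, CyclotomicCastle.Equivalent α β) := by
  have hC : (ℓ = 2 ∧ c = 4 ∧ 11 ≤ p) ∨ (ℓ = 5 ∧ c = 5 ∧ 7 ≤ p) := by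
    simp only [Set.mem_insert_iff, Set.mem_singleton_iff, Prod.mk.injEq] at hℓ
    rcases hℓ with ⟨h1, h2, rfl⟩ | ⟨h1, h2, rfl⟩
    · exact Or.inl ⟨h1, h2, hp₀⟩
    · exact Or.inr ⟨h1, h2, hp₀⟩
  have hp7 : 7 ≤ p := by rcases hC with h | h <;> omega
  have hodd : p % 2 = 1 := hp.eq_two_or_odd.resolve_left (by omega)
  have hpr : p = 2 * ((p - 1) / 2) + 1 := by omega
  generalize (p - 1) / 2 = r at *
  have hr2 : r % 2 = 1 := hr.eq_two_or_odd.resolve_left (by omega)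
  refine ⟨?_, fun N hN hcop => ⟨fun q hq hqN hrq hord => ?_, fun hq α hα hmem hhouse => ?_⟩⟩
  · rw [Nat.ModEq]
    omega
  · have := Fact.mk hq
    -- `ℓ` is a unit modulo `q` because `N` is prime to `ℓ`, so its order divides `q - 1`.
    refine hrq (hord.trans (ZMod.orderOf_dvd_card_sub_one ?_))
    rw [Ne, ZMod.natCast_eq_zero_iff]
    intro hqℓ
    have := Nat.dvd_gcd hqN (hqℓ.mul_right p)
    rw [hcop.gcd_eq_one] at this
    exact hq.one_lt.ne' (Nat.dvd_one.1 this)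
  · exact (CyclotomicCastle.reducible_of_mul_conj hp hpr hr (Nat.odd_iff.2 hr2) hC N hN hcop hq hα
      hmem (CyclotomicCastle.mul_conj_eq_of_house (Nat.mul_pos hp.pos hN).ne' hα hmem
        hhouse)).covered_or
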